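/- Let $\mathbb{M}$ be a connected smooth Riemannian manifold of dimension $d$ without boundary, with Riemannian distance $\mathrm{dist}$, open balls $B(x,r)$, Riemannian volume measure $\mu$ (given in charts by $\sqrt{\det(g_{ij})}\,dx_1\cdots dx_d$) and exponential maps $\mathrm{Exp}_x$. For $p:\mathbb{M}\to\mathbb{R}$ and $S\subset\mathbb{M}$ write $\|p\|_{C(S)}=\sup_{x\in S}|p(x)|$ and $\|\nabla p\|_{C(S)}=\sup_{x\in S}\sup_{0\ne V\in T\mathbb{M}_x}|\nabla p(x)(V)|/\|V\|$ (values in $[0,\infty]$). Let $\varPi\subset C^1(\mathbb{M})$ be a finite dimensional space of real functions for which there are constants $\mathfrak{D},\mathfrak{M}$ and $r^\sharp>0$ such that for all $p\in\varPi$, $0<r<r^\sharp$ and $x\in\mathbb{M}$, $$\|p\|_{C(B(x,2r))}\le 2^{\mathfrak{D}}\|p\|_{C(B(x,r))},\qquad \|\nabla p\|_{C(B(x,r))}\le\frac{\mathfrak{M}}{r}\|p\|_{C(B(x,r))}.$$ Let $\Omega\subset\mathbb{M}$ be compact and satisfy an interior cone condition of radius $r^\flat>0$ and aperture $\omega\in(0,\pi/2)$: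 for every $z\in\Omega$ there is a unit vector $v\in T\mathbb{M}_z$ such that $\mathrm{Exp}_z$ is defined on the cone $C=\{w\in T\mathbb{M}_z : \|w\|\le r^\flat,\ \langle v,w\rangle\ge\|w\|\cos\omega\}$ and $\mathrm{Exp}_z(C)\subset\Omega$. Let $r_\Omega=\inf_{x\in\Omega}r_x$, where the injectivity radius $r_x\in(0,\infty]$ is the supremum of all $r>0$ such that $\mathrm{Exp}_x$ is defined on the open ball of radius $r$ around $0\in T\mathbb{M}_x$ and is there a smooth diffeomorphism onto an open subset of $\mathbb{M}$. Put $r^*=\min(r_\Omega,r^\sharp,r^\flat)$. Then there is a constant $\mathfrak{N}>0$ such that for all real $1\le q<\infty$, all $x_0\in\Omega$, all $0<R\le r^*$ and all $p\in\varPi$, $$\|p\|_{C(\overline{B(x_0,R)}\cap\Omega)}\le\mathfrak{N}\,R^{-d/q}\,\|p\|_{L_q(B(x_0,R)\cap\Omega)},$$ where the $L_q$ norm is taken with respect to $\mu$. -/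

import Mathlib

open scoped Bundle Manifold ContDiff ENNReal Topology

noncomputable section

namespace RiemannianNikolskii

section Defs

variable {d : ℕ} {M : Type*} [MetricSpace M] [ChartedSpace (EuclideanSpace ℝ (Fin d)) M]

/-! ### Riemannian metric, Christoffel symbols and volume in charts

Throughout, `e` is a chart of the manifold, a homeomorphism from an open subset of `M` onto an
open subset of `ℝᵈ`, and `𝓡 d` is the model of `d`-dimensional manifolds without boundary. -/

section Metric

variable [Bundle.RiemannianBundle (fun x : M => TangentSpace (𝓡 d) x)]

/-- The metric tensor in the chart `e`: for a point `y` of the target of `e`, the bilinear form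
`g_y(a, b) = ∑ g_ij(y) a_i b_j` on coordinate vectors `a`, `b`. -/
def chartMetric (e : OpenPartialHomeomorph M (EuclideanSpace ℝ (Fin d)))
    (y a b : EuclideanSpace ℝ (Fin d)) : ℝ :=
  inner ℝ (mfderiv (𝓡 d) (𝓡 d) e.symm y a) (mfderiv (𝓡 d) (𝓡 d) e.symm y b)

/-- The derivative `(∂_c g)_y(a, b)` of the metric tensor in the chart `e`, in direction `c`. -/
def chartMetricDeriv (e : OpenPartialHomeomorph M (EuclideanSpace ℝ (Fin d)))
    (y c a b : EuclideanSpace ℝ (Fin d)) : ℝ :=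
  fderiv ℝ (fun y' => chartMetric e y' a b) y c

/-- The Christoffel symbols of the first kind in the chart `e`, as a trilinear form:
`Γ(a, b; c) = ½ (∂_a g(b, c) + ∂_b g(a, c) - ∂_c g(a, b))`. -/
def christoffel (e : OpenPartialHomeomorph M (EuclideanSpace ℝ (Fin d)))
    (y a b c : EuclideanSpace ℝ (Fin d)) : ℝ :=
  (chartMetricDeriv e y a b c + chartMetricDeriv e y b a c - chartMetricDeriv e y c a b) / 2

/-- The volume density `√(det (g_ij))` in the chart `e`. -/
def volumeDensity (e : OpenPartialHomeomorph M (EuclideanSpace ℝ (Fin d)))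
    (y : EuclideanSpace ℝ (Fin d)) : ℝ :=
  Real.sqrt (Matrix.det (Matrix.of fun i j : Fin d =>
    chartMetric e y (EuclideanSpace.single i 1) (EuclideanSpace.single j 1)))

/-- The measure `√(det (g_ij)) dx₁ ⋯ dx_d` on the domain of the chart `e`, extended by zero to
the rest of `M`. -/
def chartVolume [MeasurableSpace M]
    (e : OpenPartialHomeomorph M (EuclideanSpace ℝ (Fin d))) : MeasureTheory.Measure M :=
  ((MeasureTheory.volume.restrict e.target).withDensity
    (fun y => ENNReal.ofReal (volumeDensity e y))).map e.symm

/-- The Riemannian volume measure `μ` of `M`, glued from the chart measures. These agree on the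
overlaps of charts, so the glued measure, which restricts to `chartVolume e` on the domain of
every chart `e`, is their least upper bound in the lattice of measures on `M`. -/
def riemannianVolume (d : ℕ) (M : Type*) [MetricSpace M]
    [ChartedSpace (EuclideanSpace ℝ (Fin d)) M]
    [Bundle.RiemannianBundle (fun x : M => TangentSpace (𝓡 d) x)] [MeasurableSpace M] :
    MeasureTheory.Measure M :=
  ⨆ e ∈ atlas (EuclideanSpace ℝ (Fin d)) M, chartVolume e

/-! ### Geodesics and the exponential map -/

/-- The curve `γ` is twice continuously differentiable near `t` and satisfies the geodesic
equation at `t`: for the expression `u = e ∘ γ` in any chart `e` around `γ t`,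
`g(u'', c) + Γ(u', u'; c) = 0` for all coordinate vectors `c`, that is,
`u''_k + ∑ Γ^k_ij u'_i u'_j = 0` for all `k`. -/
def IsGeodesicAt (d : ℕ) {M : Type*} [MetricSpace M]
    [ChartedSpace (EuclideanSpace ℝ (Fin d)) M]
    [Bundle.RiemannianBundle (fun x : M => TangentSpace (𝓡 d) x)] (γ : ℝ → M) (t : ℝ) : Prop :=
  ContMDiffAt 𝓘(ℝ, ℝ) (𝓡 d) 2 γ t ∧
    ∀ e ∈ atlas (EuclideanSpace ℝ (Fin d)) M, γ t ∈ e.source → ∀ c : EuclideanSpace ℝ (Fin d),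
      chartMetric e (e (γ t)) (deriv (deriv (e ∘ γ)) t) c
        + christoffel e (e (γ t)) (deriv (e ∘ γ) t) (deriv (e ∘ γ) t) c = 0

/-- `γ` is a geodesic, defined on an open interval containing `[0, 1]`, with `γ(0) = x` and
`γ'(0) = v`. -/
def IsGeodesicFrom (x : M) (v : TangentSpace (𝓡 d) x) (γ : ℝ → M) : Prop :=
  (∃ ε : ℝ, 0 < ε ∧ ∀ t ∈ Set.Ioo (-ε) (1 + ε), IsGeodesicAt d γ t) ∧
    (⟨γ 0, mfderiv 𝓘(ℝ, ℝ) (𝓡 d) γ 0 (1 : ℝ)⟩ : TangentBundle (𝓡 d) M) = ⟨x, v⟩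

/-- The domain of the exponential map at `x`: the tangent vectors `v` for which the geodesic
that starts at `x` with velocity `v` exists up to time `1`. -/
def expDomain (x : M) : Set (TangentSpace (𝓡 d) x) :=
  {v | ∃ γ : ℝ → M, IsGeodesicFrom x v γ}

open Classical in
/-- The exponential map `Exp_x`: the point at time `1` of the geodesic that starts at `x` with
velocity `v`. (Geodesics with given initial data are unique. Outside of `expDomain x` the value
`x` is a dummy.) -/
def riemannianExp (x : M) (v : TangentSpace (𝓡 d) x) : M :=
  if h : ∃ γ : ℝ → M, IsGeodesicFrom x v γ then h.choose 1 else x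

/-- `Exp_x` is defined on the open ball of radius `r` around `0` in the tangent space at `x`, and
is there a smooth diffeomorphism onto an open subset of `M`. -/
def IsExpDiffeoOn (d : ℕ) {M : Type*} [MetricSpace M]
    [ChartedSpace (EuclideanSpace ℝ (Fin d)) M]
    [Bundle.RiemannianBundle (fun x : M => TangentSpace (𝓡 d) x)] (x : M) (r : ℝ) : Prop :=
  Metric.ball (0 : TangentSpace (𝓡 d) x) r ⊆ expDomain x ∧
    ∃ Φ : PartialDiffeomorph 𝓘(ℝ, TangentSpace (𝓡 d) x) (𝓡 d) (TangentSpace (𝓡 d) x) M ∞,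
      Φ.source = Metric.ball 0 r ∧
        ∀ v ∈ Metric.ball (0 : TangentSpace (𝓡 d) x) r, Φ v = riemannianExp x v

/-- The injectivity radius `r_x` at the point `x` (infinite for instance in `ℝᵈ`). -/
def injectivityRadius (d : ℕ) {M : Type*} [MetricSpace M]
    [ChartedSpace (EuclideanSpace ℝ (Fin d)) M]
    [Bundle.RiemannianBundle (fun x : M => TangentSpace (𝓡 d) x)] (x : M) : ℝ≥0∞ :=
  ⨆ (r : ℝ) (_ : 0 < r) (_ : IsExpDiffeoOn d x r), ENNReal.ofReal r

/-- The injectivity radius `r_Ω` of a subset `Ω` of `M`. -/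
def injectivityRadiusOn (d : ℕ) {M : Type*} [MetricSpace M]
    [ChartedSpace (EuclideanSpace ℝ (Fin d)) M]
    [Bundle.RiemannianBundle (fun x : M => TangentSpace (𝓡 d) x)] (Ω : Set M) : ℝ≥0∞ :=
  ⨅ x ∈ Ω, injectivityRadius d x

/-! ### Norms and the two assumptions -/

/-- The supremum norm `‖p‖_{C(s)}` of `p` on the set `s`, with values in `[0, ∞]`. -/
def supNorm {M : Type*} (p : M → ℝ) (s : Set M) : ℝ≥0∞ :=
  ⨆ x ∈ s, ‖p x‖ₑ

/-- The norm of the covector `∇p(x)`, that is, the supremum of `|∇p(x)(V)| / ‖V‖` over the nonzero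
tangent vectors `V` at `x`. -/
def gradNorm (d : ℕ) {M : Type*} [MetricSpace M]
    [ChartedSpace (EuclideanSpace ℝ (Fin d)) M]
    [Bundle.RiemannianBundle (fun x : M => TangentSpace (𝓡 d) x)] (p : M → ℝ) (x : M) : ℝ≥0∞ :=
  ⨆ (V : TangentSpace (𝓡 d) x) (_ : V ≠ 0),
    ENNReal.ofReal (|(show ℝ from mfderiv (𝓡 d) 𝓘(ℝ, ℝ) p x V)| / ‖V‖)

/-- The supremum norm `‖∇p‖_{C(s)}` on the set `s`, with values in `[0, ∞]`. -/
def gradSupNorm (d : ℕ) {M : Type*} [MetricSpace M]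
    [ChartedSpace (EuclideanSpace ℝ (Fin d)) M]
    [Bundle.RiemannianBundle (fun x : M => TangentSpace (𝓡 d) x)] (p : M → ℝ) (s : Set M) :
    ℝ≥0∞ :=
  ⨆ x ∈ s, gradNorm d p x

/-- `P` is a finite dimensional space of `C¹` functions on `M` with the doubling property
`‖p‖_{C(B(x,2r))} ≤ 2^D ‖p‖_{C(B(x,r))}` and the Markov inequality
`‖∇p‖_{C(B(x,r))} ≤ (K / r) ‖p‖_{C(B(x,r))}` for all `p ∈ P`, `x ∈ M` and `0 < r < rs`. -/
structure FunctionSpaceAssumption (d : ℕ) {M : Type*} [MetricSpace M]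
    [ChartedSpace (EuclideanSpace ℝ (Fin d)) M]
    [Bundle.RiemannianBundle (fun x : M => TangentSpace (𝓡 d) x)]
    (P : Submodule ℝ (M → ℝ)) (D K rs : ℝ) : Prop where
  finiteDimensional : FiniteDimensional ℝ P
  contMDiff : ∀ p ∈ P, ContMDiff (𝓡 d) 𝓘(ℝ, ℝ) 1 p
  rs_pos : 0 < rs
  doubling : ∀ p ∈ P, ∀ r : ℝ, 0 < r → r < rs → ∀ x : M,
    supNorm p (Metric.ball x (2 * r)) ≤ ENNReal.ofReal (2 ^ D) * supNorm p (Metric.ball x r)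
  markov : ∀ p ∈ P, ∀ r : ℝ, 0 < r → r < rs → ∀ x : M,
    gradSupNorm d p (Metric.ball x r) ≤ ENNReal.ofReal (K / r) * supNorm p (Metric.ball x r)

/-- The closed cone of radius `r` and aperture `θ` around the direction `v` in the tangent space
at `z`. -/
def tangentCone {z : M} (r θ : ℝ) (v : TangentSpace (𝓡 d) z) : Set (TangentSpace (𝓡 d) z) :=
  {w | ‖w‖ ≤ r ∧ Real.cos θ * ‖w‖ ≤ inner ℝ v w}

/-- `Ω` is compact and satisfies the interior cone condition of radius `rb` and aperture `θ`: at
each point `z` of `Ω` there is a unit tangent vector `v` such that `Exp_z` is defined on the cone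
around `v` and maps it into `Ω`. -/
structure DomainAssumption (d : ℕ) {M : Type*} [MetricSpace M]
    [ChartedSpace (EuclideanSpace ℝ (Fin d)) M]
    [Bundle.RiemannianBundle (fun x : M => TangentSpace (𝓡 d) x)]
    (Ω : Set M) (rb θ : ℝ) : Prop where
  isCompact : IsCompact Ω
  rb_pos : 0 < rb
  aperture_pos : 0 < θ
  aperture_lt : θ < Real.pi / 2
  cone : ∀ z ∈ Ω, ∃ v : TangentSpace (𝓡 d) z, ‖v‖ = 1 ∧
    tangentCone rb θ v ⊆ expDomain z ∧ ∀ w ∈ tangentCone rb θ v, riemannianExp z w ∈ Ω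

/-- The parameter `r* = min(r_Ω, rs, rb)`. -/
def rStar (d : ℕ) {M : Type*} [MetricSpace M]
    [ChartedSpace (EuclideanSpace ℝ (Fin d)) M]
    [Bundle.RiemannianBundle (fun x : M => TangentSpace (𝓡 d) x)] (Ω : Set M) (rs rb : ℝ) :
    ℝ≥0∞ :=
  min (injectivityRadiusOn d Ω) (min (ENNReal.ofReal rs) (ENNReal.ofReal rb))

end Metric

end Defs

end RiemannianNikolskii

end

/-!
Near any point, in a chart, a geodesic is a small perturbation of a straight line, so the image
under `Exp` of a cone of length `s` contains a metric ball of radius comparable to `s`; by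
compactness of `Ω` the constants are uniform. Hence `B(x₀, R) ∩ Ω` contains a ball `B(y, r)` with
`r` comparable to `R` and, by iterated doubling, `‖p‖` on `B(x₀, R)` is at most a constant times
`m := ‖p‖_{C(B(y, r))}`. Choose a point of `B(y, r)` where `|p| > m / 2`. The Markov inequality and
the mean value inequality keep `|p| ≥ m / 4` on a concentric ball of radius comparable to `R`, whose
volume is at least a constant times `R ^ d`; integrating `|p| ^ q` over that ball finishes.
-/

noncomputable section

namespace RiemannianNikolskii

local notation "𝔼(" d ")" => EuclideanSpace ℝ (Fin d)

section MeanValue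

variable {E : Type*} [NormedAddCommGroup E] [NormedSpace ℝ E]
  {H : Type*} [TopologicalSpace H] {I : ModelWithCorners ℝ E H}
  {E' : Type*} [NormedAddCommGroup E'] [NormedSpace ℝ E']
  {H' : Type*} [TopologicalSpace H'] {I' : ModelWithCorners ℝ E' H'}
  {N : Type*} [PseudoMetricSpace N] [ChartedSpace H' N]
  [Bundle.RiemannianBundle (fun x : N => TangentSpace I' x)]

theorem pathELength_comp_le {M : Type*} [TopologicalSpace M] [ChartedSpace H M]
    [Bundle.RiemannianBundle (fun x : M => TangentSpace I x)] {f : M → N} {γ : ℝ → M} {a b : ℝ}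
    {C : NNReal} (hγ : ∀ t ∈ Set.Icc a b, MDifferentiableAt 𝓘(ℝ, ℝ) I γ t)
    (hf : ∀ t ∈ Set.Icc a b, MDifferentiableAt I I' f (γ t))
    (hC : ∀ t ∈ Set.Icc a b, ∀ v, ‖mfderiv I I' f (γ t) v‖ ≤ C * ‖v‖) :
    Manifold.pathELength I' (f ∘ γ) a b ≤ C * Manifold.pathELength I γ a b := by
  rw [Manifold.pathELength_eq_lintegral_mfderiv_Icc, Manifold.pathELength_eq_lintegral_mfderiv_Icc,
    ← MeasureTheory.lintegral_const_mul' _ _ ENNReal.coe_ne_top]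
  refine MeasureTheory.setLIntegral_mono' measurableSet_Icc fun t ht => ?_
  rw [mfderiv_comp t (hf t ht) (hγ t ht)]
  simp only [enorm]
  exact_mod_cast hC t ht _

variable [IsRiemannianManifold I' N]

theorem edist_le_pathELength {γ : ℝ → N} {a b : ℝ}
    (hγ : ContMDiffOn 𝓘(ℝ, ℝ) I' 1 γ (Set.Icc a b)) {s t : ℝ} (has : a ≤ s) (hst : s ≤ t)
    (htb : t ≤ b) : edist (γ s) (γ t) ≤ Manifold.pathELength I' γ a b := by
  rw [IsRiemannianManifold.out (I := I')]
  exact (Manifold.riemannianEDist_le_pathELength (hγ.mono (Set.Icc_subset_Icc has htb)) rfl rfl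
    hst).trans (Manifold.pathELength_mono has htb)

theorem dist_le_mul_dist_of_convex {V : Type*} [NormedAddCommGroup V] [InnerProductSpace ℝ V]
    {f : V → N} {s : Set V} {C : NNReal} (hs : Convex ℝ s)
    (hf : ∀ y ∈ s, ContMDiffAt 𝓘(ℝ, V) I' 1 f y)
    (hC : ∀ y ∈ s, ∀ v : V, ‖mfderiv 𝓘(ℝ, V) I' f y v‖ ≤ C * ‖v‖)
    {x y : V} (hx : x ∈ s) (hy : y ∈ s) : dist (f x) (f y) ≤ C * dist x y := by
  let γ : ℝ →ᴬ[ℝ] V := ContinuousAffineMap.lineMap x y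
  have hγ0 : γ 0 = x := by simp [γ, ContinuousAffineMap.coe_lineMap_eq]
  have hγ1 : γ 1 = y := by simp [γ, ContinuousAffineMap.coe_lineMap_eq]
  have hγs : ∀ t ∈ Set.Icc (0 : ℝ) 1, γ t ∈ s := fun t ht => hs.lineMap_mem hx hy ht
  have hγ : ContMDiff 𝓘(ℝ, ℝ) 𝓘(ℝ, V) 1 γ := γ.contDiff.contMDiff
  have hfγ : ContMDiffOn 𝓘(ℝ, ℝ) I' 1 (f ∘ γ) (Set.Icc 0 1) := fun t ht =>
    ((hf _ (hγs t ht)).comp t hγ.contMDiffAt).contMDiffWithinAt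
  have key : edist (f x) (f y) ≤ C * edist x y := by
    calc edist (f x) (f y) = edist ((f ∘ γ) 0) ((f ∘ γ) 1) := by
          rw [Function.comp_apply, Function.comp_apply, hγ0, hγ1]
      _ ≤ Manifold.pathELength I' (f ∘ γ) 0 1 := edist_le_pathELength hfγ le_rfl zero_le_one le_rfl
      _ ≤ C * Manifold.pathELength 𝓘(ℝ, V) γ 0 1 :=
        pathELength_comp_le (fun t _ => hγ.mdifferentiableAt one_ne_zero)
          (fun t ht => (hf _ (hγs t ht)).mdifferentiableAt one_ne_zero) fun t ht v => by
            rw [norm_tangentSpace_vectorSpace]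
            exact hC _ (hγs t ht) v
      _ = C * edist x y := by
        rw [Manifold.pathELength_eq_lintegral_mfderivWithin_Icc,
          ← lintegral_fderiv_lineMap_eq_edist]
        simp only [mfderivWithin_eq_fderivWithin, enorm_tangentSpace_vectorSpace]
        rfl
  rw [edist_nndist, edist_nndist] at key
  exact_mod_cast key

variable {M : Type*} [PseudoMetricSpace M] [ChartedSpace H M]
  [Bundle.RiemannianBundle (fun x : M => TangentSpace I x)] [IsRiemannianManifold I M]

theorem dist_le_mul_dist_of_ball {f : M → N} {z : M} {ρ : ℝ} {C : NNReal}
    (hf : ContMDiffOn I I' 1 f (Metric.ball z ρ))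
    (hC : ∀ x ∈ Metric.ball z ρ, ∀ v : TangentSpace I x, ‖mfderiv I I' f x v‖ ≤ C * ‖v‖)
    {x : M} (hx : x ∈ Metric.ball z ρ) : dist (f z) (f x) ≤ C * dist z x := by
  have main : ∀ l : ℝ≥0∞, edist z x < l → l < ENNReal.ofReal ρ → edist (f z) (f x) ≤ C * l := by
    intro l hl hlρ
    rw [IsRiemannianManifold.out (I := I)] at hl
    obtain ⟨γ, rfl, rfl, hγ, hlen, -, -⟩ :=
      Manifold.exists_lt_locally_constant_of_riemannianEDist_lt hl zero_lt_one
    -- a path shorter than the radius stays in the ball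
    have hmem : ∀ t ∈ Set.Icc (0 : ℝ) 1, γ t ∈ Metric.ball (γ 0) ρ := fun t ht => by
      rw [← Metric.eball_ofReal, Metric.mem_eball, edist_comm]
      exact (edist_le_pathELength hγ.contMDiffOn le_rfl ht.1 ht.2).trans_lt (hlen.trans hlρ)
    have hfat : ∀ t ∈ Set.Icc (0 : ℝ) 1, ContMDiffAt I I' 1 f (γ t) := fun t ht =>
      hf.contMDiffAt (Metric.isOpen_ball.mem_nhds (hmem t ht))
    have hfγ : ContMDiffOn 𝓘(ℝ, ℝ) I' 1 (f ∘ γ) (Set.Icc 0 1) := fun t ht =>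
      ((hfat t ht).comp t hγ.contMDiffAt).contMDiffWithinAt
    calc edist (f (γ 0)) (f (γ 1)) ≤ Manifold.pathELength I' (f ∘ γ) 0 1 :=
          edist_le_pathELength hfγ le_rfl zero_le_one le_rfl
      _ ≤ C * Manifold.pathELength I γ 0 1 :=
          pathELength_comp_le (fun t _ => hγ.mdifferentiableAt one_ne_zero)
            (fun t ht => (hfat t ht).mdifferentiableAt one_ne_zero) fun t ht => hC _ (hmem t ht)
      _ ≤ C * l := by gcongr
  have hlim : Filter.Tendsto (fun l : ℝ≥0∞ => C * l) (𝓝[>] edist z x) (𝓝 (C * edist z x)) :=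
    (ENNReal.Tendsto.const_mul Filter.tendsto_id (Or.inr ENNReal.coe_ne_top)).mono_left
      nhdsWithin_le_nhds
  have hxρ : edist z x < ENNReal.ofReal ρ := by
    rwa [edist_comm, ← Metric.mem_eball, Metric.eball_ofReal]
  have := nhdsGT_neBot_of_exists_gt ⟨_, hxρ⟩
  have key : edist (f z) (f x) ≤ C * edist z x := by
    refine ge_of_tendsto hlim ?_
    filter_upwards [Ioo_mem_nhdsGT hxρ] with l hl using main l hl.1 hl.2
  rw [edist_nndist, edist_nndist] at key
  exact_mod_cast key

end MeanValue

section SecondOrder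

variable {E : Type*} [NormedAddCommGroup E] [NormedSpace ℝ E]

theorem norm_sub_le_of_hasDerivWithinAt_Icc {f f' : ℝ → E} {C : ℝ}
    (hf : ∀ t ∈ Set.Icc (0 : ℝ) 1, HasDerivWithinAt f (f' t) (Set.Icc 0 1) t)
    (hC : ∀ t ∈ Set.Icc (0 : ℝ) 1, ‖f' t‖ ≤ C) {t : ℝ} (ht : t ∈ Set.Icc (0 : ℝ) 1) :
    ‖f t - f 0‖ ≤ C := by
  have hC0 : 0 ≤ C := (norm_nonneg _).trans (hC t ht)
  refine (norm_image_sub_le_of_norm_deriv_le_segment' hf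
    (fun x hx => hC x (Set.Ico_subset_Icc_self hx)) t ht).trans ?_
  exact mul_le_of_le_one_right hC0 (by linarith [ht.2])

theorem norm_sub_le_of_norm_second_deriv_le {δ δ' δ'' : ℝ → E} {κ : ℝ} (hκ : 0 ≤ κ)
    (hκ' : κ ≤ 1 / 2) (hδ : ∀ t ∈ Set.Icc (0 : ℝ) 1, HasDerivWithinAt δ (δ' t) (Set.Icc 0 1) t)
    (hδ' : ∀ t ∈ Set.Icc (0 : ℝ) 1, HasDerivWithinAt δ' (δ'' t) (Set.Icc 0 1) t)
    (h0 : δ 0 = 0) (hδ'' : ∀ t ∈ Set.Icc (0 : ℝ) 1, ‖δ'' t‖ ≤ κ * max ‖δ t‖ ‖δ' t‖) :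
    ‖δ 1 - δ' 0‖ ≤ 2 * κ * ‖δ' 0‖ := by
  have z0 : (0 : ℝ) ∈ Set.Icc (0 : ℝ) 1 := by simp
  obtain ⟨τ, hτ, hmax⟩ := isCompact_Icc.exists_isMaxOn ⟨0, z0⟩
    (ContinuousOn.norm fun t ht => (hδ' t ht).continuousWithinAt)
  have hδ_le : ∀ t ∈ Set.Icc (0 : ℝ) 1, ‖δ t‖ ≤ ‖δ' τ‖ := fun t ht => by
    simpa [h0] using norm_sub_le_of_hasDerivWithinAt_Icc hδ hmax ht
  have hδ'_sub : ∀ t ∈ Set.Icc (0 : ℝ) 1, ‖δ' t - δ' 0‖ ≤ κ * ‖δ' τ‖ := fun t ht =>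
    norm_sub_le_of_hasDerivWithinAt_Icc hδ' (fun t ht => (hδ'' t ht).trans
      (mul_le_mul_of_nonneg_left (max_le (hδ_le t ht) (hmax ht)) hκ)) ht
  have hτ_le : ‖δ' τ‖ ≤ 2 * ‖δ' 0‖ := by
    have h1 : ‖δ' τ‖ ≤ ‖δ' τ - δ' 0‖ + ‖δ' 0‖ := norm_le_norm_sub_add _ _
    have h2 : κ * ‖δ' τ‖ ≤ 1 / 2 * ‖δ' τ‖ := by gcongr
    linarith [hδ'_sub τ hτ]
  have hfin : ‖δ 1 - (1 : ℝ) • δ' 0 - (δ 0 - (0 : ℝ) • δ' 0)‖ ≤ κ * ‖δ' τ‖ :=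
    norm_sub_le_of_hasDerivWithinAt_Icc (f := fun t => δ t - t • δ' 0)
      (f' := fun t => δ' t - δ' 0) (fun t ht => by
        simpa only [one_smul, id] using
          (hδ t ht).fun_sub ((hasDerivWithinAt_id t (Set.Icc 0 1)).smul_const (δ' 0)))
      hδ'_sub (by simp)
  simp only [h0, one_smul, zero_smul, sub_zero] at hfin
  calc ‖δ 1 - δ' 0‖ ≤ κ * ‖δ' τ‖ := hfin
    _ ≤ κ * (2 * ‖δ' 0‖) := by gcongr
    _ = 2 * κ * ‖δ' 0‖ := by ring

theorem hasDerivAt_deriv_of_contDiffAt {u : ℝ → E} {t : ℝ} (hu : ContDiffAt ℝ 2 u t) :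
    HasDerivAt (deriv u) (deriv (deriv u) t) t :=
  (((hu.fderiv_right (m := 1) (by norm_num)).clm_apply contDiffAt_const).differentiableAt
    one_ne_zero).hasDerivAt

end SecondOrder

section Spray

variable {E : Type*} [NormedAddCommGroup E] [NormedSpace ℝ E]

/-- The geodesic spray of a metric tensor `G` on a vector space: the geodesic equation of `G` is
`u'' = geodesicSpray G u u'`. With `D` the derivative of `G` at `y`, it is characterized by
`G y (geodesicSpray G y v) c = -(D v v c - ½ D c v v)` for all `c`. -/
def geodesicSpray (G : E → E →L[ℝ] E →L[ℝ] ℝ) (y v : E) : E :=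
  -(G y).inverse (fderiv ℝ (fun z => G z v) y v - (1 / 2 : ℝ) • fderiv ℝ (fun z => G z v v) y)

variable {G : E → E →L[ℝ] E →L[ℝ] ℝ} {y : E}

theorem eq_geodesicSpray_of_forall {h v : E} (hd : DifferentiableAt ℝ G y)
    (hG : (G y).IsInvertible)
    (hh : ∀ c, G y h c +
      (fderiv ℝ (fun z => G z v c) y v - 1 / 2 * fderiv ℝ (fun z => G z v v) y c) = 0) :
    h = geodesicSpray G y v := by
  have hGh : G y h =
      -(fderiv ℝ (fun z => G z v) y v - (1 / 2 : ℝ) • fderiv ℝ (fun z => G z v v) y) := by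
    ext c
    have hc : fderiv ℝ (fun z => G z v c) y v = fderiv ℝ (fun z => G z v) y v c := by
      rw [fderiv_clm_apply (hd.clm_apply (differentiableAt_const v)) (differentiableAt_const c)]
      simp
    simpa [hc] using eq_neg_of_add_eq_zero_left (hh c)
  rw [geodesicSpray, ← map_neg, ← hGh, hG.inverse_apply_self]

theorem geodesicSpray_smul (c : ℝ) (v : E) :
    geodesicSpray G y (c • v) = c ^ 2 • geodesicSpray G y v := by
  have h1 : fderiv ℝ (fun z => G z (c • v)) y = c • fderiv ℝ (fun z => G z v) y := by
    simp only [map_smul]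
    exact congrFun (fderiv_const_smul_field (𝕜 := ℝ) (f := fun z => G z v) c) y
  have h2 : fderiv ℝ (fun z => G z (c • v) (c • v)) y = c ^ 2 • fderiv ℝ (fun z => G z v v) y := by
    simp only [map_smul, smul_apply, smul_smul, ← pow_two]
    exact congrFun (fderiv_const_smul_field (𝕜 := ℝ) (f := fun z => G z v v) (c ^ 2)) y
  rw [geodesicSpray, h1, h2, geodesicSpray, smul_neg, ← map_smul, smul_sub, smul_comm (c ^ 2)]
  simp only [smul_apply, map_smul, smul_smul, pow_two]

theorem contDiffAt_geodesicSpray [CompleteSpace E] {v : E} (hG : ContDiffAt ℝ 2 G y)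
    (hinv : (G y).IsInvertible) :
    ContDiffAt ℝ 1 (fun p : E × E => geodesicSpray G p.1 p.2) (y, v) := by
  have hfst : ContDiffAt ℝ 1 (Prod.fst : E × E → E) (y, v) := contDiffAt_fst
  have hsnd : ContDiffAt ℝ 1 (Prod.snd : E × E → E) (y, v) := contDiffAt_snd
  have hinverse : ContDiffAt ℝ 1 (fun p : E × E => (G p.1).inverse) (y, v) :=
    ContDiffAt.comp (g := ContinuousLinearMap.inverse) (y, v) hinv.contDiffAt_map_inverse
      ((hG.of_le one_le_two).comp (y, v) hfst)
  have hGv : ContDiffAt ℝ 2 (Function.uncurry fun (p : E × E) z => G z p.2) ((y, v), y) :=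
    (hG.comp ((y, v), y) contDiffAt_snd).clm_apply (contDiffAt_snd.comp _ contDiffAt_fst)
  have hGvv : ContDiffAt ℝ 2 (Function.uncurry fun (p : E × E) z => G z p.2 p.2) ((y, v), y) :=
    hGv.clm_apply (contDiffAt_snd.comp _ contDiffAt_fst)
  exact (hinverse.clm_apply (((hGv.fderiv hfst (by norm_num)).clm_apply hsnd).sub
    ((hGvv.fderiv hfst (by norm_num)).const_smul _))).neg

theorem hasStrictFDerivAt_geodesicSpray_zero [CompleteSpace E] (hG : ContDiffAt ℝ 2 G y)
    (hinv : (G y).IsInvertible) :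
    HasStrictFDerivAt (fun p : E × E => geodesicSpray G p.1 p.2) (0 : E × E →L[ℝ] E) (y, 0) := by
  have h := (contDiffAt_geodesicSpray (v := 0) hG hinv).hasStrictFDerivAt one_ne_zero
  suffices h0 : fderiv ℝ (fun p : E × E => geodesicSpray G p.1 p.2) (y, 0) = 0 by rwa [h0] at h
  have hzero : ∀ z, geodesicSpray G z 0 = 0 := fun z => by
    simpa using geodesicSpray_smul (G := G) (y := z) 0 0
  refine ContinuousLinearMap.prod_ext (ContinuousLinearMap.ext fun a => ?_)
    (ContinuousLinearMap.ext fun b => ?_)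
  · have hline : HasDerivAt (fun t : ℝ => (y + t • a, (0 : E))) (a, 0) 0 := by
      simpa using (((hasDerivAt_id (0 : ℝ)).smul_const a).const_add y).prodMk
        (hasDerivAt_const (0 : ℝ) (0 : E))
    have hcomp := (h.hasFDerivAt.comp_hasDerivAt_of_eq (0 : ℝ) hline (by simp)).unique
      (f₁' := 0) (by simpa [Function.comp_def, hzero] using hasDerivAt_const (0 : ℝ) (0 : E))
    simpa using hcomp
  · have hline : HasDerivAt (fun t : ℝ => (y, t • b)) (0, b) 0 := by
      simpa using (hasDerivAt_const (0 : ℝ) y).prodMk ((hasDerivAt_id (0 : ℝ)).smul_const b)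
    have hcomp := (h.hasFDerivAt.comp_hasDerivAt_of_eq (0 : ℝ) hline (by simp)).unique
      (f₁' := 0) (by
        simpa [Function.comp_def, geodesicSpray_smul] using
          ((hasDerivAt_id (0 : ℝ)).pow 2).smul_const (geodesicSpray G y b))
    simpa using hcomp

theorem exists_lipschitzOnWith_geodesicSpray [CompleteSpace E] (hG : ContDiffAt ℝ 2 G y)
    (hinv : (G y).IsInvertible) {κ : NNReal} (hκ : 0 < κ) :
    ∃ ε > 0, LipschitzOnWith κ (fun p : E × E => geodesicSpray G p.1 p.2)
      (Metric.closedBall y ε ×ˢ Metric.closedBall 0 ε) := by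
  obtain ⟨s, hs, hlip⟩ := (hasStrictFDerivAt_geodesicSpray_zero hG hinv)
    |>.exists_lipschitzOnWith_of_nnnorm_lt κ (by simpa using hκ)
  obtain ⟨ε, hε, hεs⟩ := Metric.nhds_basis_closedBall.mem_iff.1 hs
  exact ⟨ε, hε, hlip.mono (by rwa [closedBall_prod_same])⟩

theorem isInvertible_of_pos [FiniteDimensional ℝ E] {B : E →L[ℝ] E →L[ℝ] ℝ}
    (hB : ∀ v, v ≠ 0 → 0 < B v v) : B.IsInvertible := by
  have hinj : Function.Injective (B : E →ₗ[ℝ] E →L[ℝ] ℝ) := by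
    refine (injective_iff_map_eq_zero _).2 fun v hv => ?_
    by_contra hne
    exact (hB v hne).ne' (congrArg (· v) hv)
  have hdim : Module.finrank ℝ E = Module.finrank ℝ (E →L[ℝ] ℝ) :=
    Subspace.dual_finrank_eq.symm.trans
      (LinearMap.toContinuousLinearMap (𝕜 := ℝ) (E := E) (F' := ℝ)).finrank_eq
  exact ⟨(LinearMap.linearEquivOfInjective _ hinj hdim).toContinuousLinearEquiv, rfl⟩

theorem hasDerivAt_quadratic_deriv_of_geodesic {u : ℝ → E} {t : ℝ} (hu : ContDiffAt ℝ 2 u t)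
    (hG : DifferentiableAt ℝ G (u t)) (hsymm : ∀ a b, G (u t) a b = G (u t) b a)
    (hgeo : G (u t) (deriv (deriv u) t) (deriv u t) +
      fderiv ℝ (fun z => G z (deriv u t) (deriv u t)) (u t) (deriv u t) / 2 = 0) :
    HasDerivAt (fun s => G (u s) (deriv u s) (deriv u s)) 0 t := by
  have hu' : HasDerivAt u (deriv u t) t := (hu.differentiableAt two_ne_zero).hasDerivAt
  have hu'' : HasDerivAt (deriv u) (deriv (deriv u) t) t := hasDerivAt_deriv_of_contDiffAt hu
  have hDG : ∀ v, fderiv ℝ (fun z => G z v v) (u t) v = fderiv ℝ G (u t) v v v := fun v => by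
    rw [fderiv_clm_apply (hG.clm_apply (differentiableAt_const v)) (differentiableAt_const v),
      fderiv_clm_apply hG (differentiableAt_const v)]
    simp
  have hGu : HasDerivAt (fun s => G (u s)) (fderiv ℝ G (u t) (deriv u t)) t :=
    HasFDerivAt.comp_hasDerivAt (l := G) (f := u) t hG.hasFDerivAt hu'
  refine ((hGu.clm_apply hu'').clm_apply hu'').congr_deriv ?_
  rw [hDG] at hgeo
  rw [add_apply, hsymm (deriv u t) (deriv (deriv u) t)]
  linarith

end Spray

section ChartMaps

variable {d : ℕ} {M : Type*} [MetricSpace M] [ChartedSpace 𝔼(d) M]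
  {e : OpenPartialHomeomorph M 𝔼(d)}

/-- The differential of the chart `e` at `x`, valued in the coordinate space `ℝᵈ` rather than in a
tangent space of it, so that coordinate vectors carry the Euclidean norm. -/
def chartDifferential (e : OpenPartialHomeomorph M 𝔼(d)) (x : M) :
    TangentSpace (𝓡 d) x →L[ℝ] 𝔼(d) :=
  mfderiv (𝓡 d) (𝓡 d) e x

variable [IsManifold (𝓡 d) ∞ M]

theorem chartDifferential_surjective (he : e ∈ atlas 𝔼(d) M) {x : M} (hx : x ∈ e.source) :
    Function.Surjective (chartDifferential e x) :=
  (mdifferentiable_of_mem_atlas he).mfderiv_surjective hx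

theorem chartDifferential_mfderiv_symm (he : e ∈ atlas 𝔼(d) M) {y : 𝔼(d)} (hy : y ∈ e.target)
    (a : 𝔼(d)) :
    chartDifferential e (e.symm y) (mfderiv (𝓡 d) (𝓡 d) e.symm y a) = a :=
  congrArg (fun T => T a) ((mdifferentiable_of_mem_atlas (I := 𝓡 d) he).comp_symm_deriv hy)

theorem mfderiv_symm_injective (he : e ∈ atlas 𝔼(d) M) {y : 𝔼(d)} (hy : y ∈ e.target) :
    Function.Injective (mfderiv (𝓡 d) (𝓡 d) e.symm y) :=
  (mdifferentiable_of_mem_atlas he).symm.mfderiv_injective hy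

theorem deriv_comp_eq_chartDifferential {γ : ℝ → M} {t : ℝ}
    (hγ : MDifferentiableAt 𝓘(ℝ, ℝ) (𝓡 d) γ t) (he : e ∈ atlas 𝔼(d) M) (ht : γ t ∈ e.source) :
    deriv (e ∘ γ) t = chartDifferential e (γ t) (mfderiv 𝓘(ℝ, ℝ) (𝓡 d) γ t (1 : ℝ)) := by
  have hcomp := mfderiv_comp t ((mdifferentiable_of_mem_atlas (I := 𝓡 d) he).mdifferentiableAt ht)
    hγ
  rw [mfderiv_eq_fderiv] at hcomp
  exact congrArg (fun T => T (1 : ℝ)) hcomp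

end ChartMaps

section ChartMetric

variable {d : ℕ} {M : Type*} [MetricSpace M] [ChartedSpace 𝔼(d) M]
  [Bundle.RiemannianBundle (fun x : M => TangentSpace (𝓡 d) x)]
  {e : OpenPartialHomeomorph M 𝔼(d)}

/-- `chartMetric e y` as a continuous bilinear form, so that the metric tensor in the chart `e`
becomes a map between normed spaces. -/
def chartMetricForm (e : OpenPartialHomeomorph M 𝔼(d)) (y : 𝔼(d)) : 𝔼(d) →L[ℝ] 𝔼(d) →L[ℝ] ℝ :=
  (innerSL ℝ).bilinearComp (mfderiv (𝓡 d) (𝓡 d) e.symm y) (mfderiv (𝓡 d) (𝓡 d) e.symm y)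

theorem chartMetricForm_apply (e : OpenPartialHomeomorph M 𝔼(d)) (y a b : 𝔼(d)) :
    chartMetricForm e y a b = chartMetric e y a b := rfl

theorem chartMetric_self (e : OpenPartialHomeomorph M 𝔼(d)) (y a : 𝔼(d)) :
    chartMetric e y a a = ‖mfderiv (𝓡 d) (𝓡 d) e.symm y a‖ ^ 2 :=
  real_inner_self_eq_norm_sq _

variable [IsManifold (𝓡 d) ∞ M]

theorem isInvertible_chartMetricForm (he : e ∈ atlas 𝔼(d) M) {y : 𝔼(d)} (hy : y ∈ e.target) :
    (chartMetricForm e y).IsInvertible :=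
  isInvertible_of_pos fun v hv => by
    rw [chartMetricForm_apply, chartMetric_self]
    have := (map_ne_zero_iff _ (mfderiv_symm_injective he hy)).2 hv
    positivity

variable [IsContMDiffRiemannianBundle (𝓡 d) ∞ 𝔼(d) (fun x : M => TangentSpace (𝓡 d) x)]

theorem contDiffOn_chartMetric (he : e ∈ atlas 𝔼(d) M) (a b : 𝔼(d)) :
    ContDiffOn ℝ ∞ (fun y => chartMetric e y a b) e.target := by
  have hsymm : ContMDiffOn (𝓡 d) (𝓡 d) ∞ e.symm e.target :=
    contMDiffOn_symm_of_mem_maximalAtlas (StructureGroupoid.subset_maximalAtlas _ he)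
  have hpush : ∀ a : 𝔼(d), ContMDiffOn (𝓡 d) ((𝓡 d).prod 𝓘(ℝ, 𝔼(d))) ∞
      (fun y => (⟨e.symm y, mfderiv (𝓡 d) (𝓡 d) e.symm y a⟩ : TangentBundle (𝓡 d) M))
      e.target := fun a => by
    have hconst : ContMDiff (𝓡 d) ((𝓡 d).prod 𝓘(ℝ, 𝔼(d))) ∞
        (fun y : 𝔼(d) => (⟨y, a⟩ : TangentBundle (𝓡 d) 𝔼(d))) :=
      contMDiff_vectorSpace_iff_contDiff.2 contDiff_const
    refine ((hsymm.contMDiffOn_tangentMapWithin (m := ∞) (by simp)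
      e.open_target.uniqueMDiffOn).comp hconst.contMDiffOn fun y hy => hy).congr fun y hy => ?_
    simp [tangentMapWithin, mfderivWithin_of_isOpen e.open_target hy]
  exact contMDiffOn_iff_contDiffOn.1 ((hpush a).inner_bundle (hpush b))

theorem contDiffAt_chartMetricForm (he : e ∈ atlas 𝔼(d) M) {y : 𝔼(d)} (hy : y ∈ e.target) :
    ContDiffAt ℝ 2 (chartMetricForm e) y := by
  have h : ContDiffOn ℝ ∞ (chartMetricForm e) e.target :=
    contDiffOn_clm_apply.2 fun a => contDiffOn_clm_apply.2 fun b => contDiffOn_chartMetric he a b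
  exact (h.contDiffAt (e.open_target.mem_nhds hy)).of_le ENat.LEInfty.out

end ChartMetric

section Geodesics

variable {d : ℕ} {M : Type*} [MetricSpace M] [ChartedSpace 𝔼(d) M]
  [Bundle.RiemannianBundle (fun x : M => TangentSpace (𝓡 d) x)] [IsManifold (𝓡 d) ∞ M]
  {e : OpenPartialHomeomorph M 𝔼(d)} {γ : ℝ → M} {t : ℝ}

theorem IsGeodesicAt.contDiffAt_comp (hγ : IsGeodesicAt d γ t) (he : e ∈ atlas 𝔼(d) M)
    (ht : γ t ∈ e.source) : ContDiffAt ℝ 2 (e ∘ γ) t :=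
  contMDiffAt_iff_contDiffAt.1 <| (contMDiffAt_of_mem_maximalAtlas
    (IsManifold.subset_maximalAtlas (n := 2) he) ht).comp t hγ.1

theorem norm_mfderiv_symm_chartDifferential (he : e ∈ atlas 𝔼(d) M) {x : M} (hx : x ∈ e.source)
    (w : TangentSpace (𝓡 d) x) :
    ‖mfderiv (𝓡 d) (𝓡 d) e.symm (e x) (chartDifferential e x w)‖ = ‖w‖ := by
  have hinv : (mfderiv (𝓡 d) (𝓡 d) e.symm (e x) (chartDifferential e x w) : 𝔼(d)) = w :=
    congrArg (fun L => L w) ((mdifferentiable_of_mem_atlas (I := 𝓡 d) he).symm_comp_deriv hx)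
  -- the tangent spaces at `e.symm (e x)` and `x` are only propositionally equal
  have transport : ∀ x', x' = x → ∀ v : TangentSpace (𝓡 d) x', (show 𝔼(d) from v) = w →
      ‖v‖ = ‖w‖ := by
    rintro _ rfl v rfl
    rfl
  exact transport _ (e.left_inv hx) _ hinv

theorem sq_norm_mfderiv_eq_chartMetric (hγ : MDifferentiableAt 𝓘(ℝ, ℝ) (𝓡 d) γ t)
    (he : e ∈ atlas 𝔼(d) M) (ht : γ t ∈ e.source) :
    ‖mfderiv 𝓘(ℝ, ℝ) (𝓡 d) γ t (1 : ℝ)‖ ^ 2 =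
      chartMetric e (e (γ t)) (deriv (e ∘ γ) t) (deriv (e ∘ γ) t) := by
  rw [chartMetric_self, deriv_comp_eq_chartDifferential hγ he ht,
    norm_mfderiv_symm_chartDifferential he ht]

variable [IsContMDiffRiemannianBundle (𝓡 d) ∞ 𝔼(d) (fun x : M => TangentSpace (𝓡 d) x)]

theorem IsGeodesicAt.deriv_deriv_eq_geodesicSpray (hγ : IsGeodesicAt d γ t)
    (he : e ∈ atlas 𝔼(d) M) (ht : γ t ∈ e.source) :
    deriv (deriv (e ∘ γ)) t = geodesicSpray (chartMetricForm e) (e (γ t)) (deriv (e ∘ γ) t) := by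
  refine eq_geodesicSpray_of_forall ((contDiffAt_chartMetricForm he
    (e.map_source ht)).differentiableAt two_ne_zero) (isInvertible_chartMetricForm he
    (e.map_source ht)) fun c => ?_
  rw [← hγ.2 e he ht c]
  simp only [chartMetricForm_apply, christoffel, chartMetricDeriv]
  ring

theorem IsGeodesicAt.hasDerivAt_sq_norm_mfderiv (hγ : IsGeodesicAt d γ t) :
    HasDerivAt (fun s => ‖mfderiv 𝓘(ℝ, ℝ) (𝓡 d) γ s (1 : ℝ)‖ ^ 2) 0 t := by
  set e := chartAt 𝔼(d) (γ t)
  have he : e ∈ atlas 𝔼(d) M := chart_mem_atlas _ _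
  have ht : γ t ∈ e.source := mem_chart_source _ _
  have hchart : HasDerivAt (fun s => chartMetricForm e (e (γ s)) (deriv (e ∘ γ) s)
      (deriv (e ∘ γ) s)) 0 t := by
    refine hasDerivAt_quadratic_deriv_of_geodesic (u := e ∘ γ) (hγ.contDiffAt_comp he ht)
      ((contDiffAt_chartMetricForm he (e.map_source ht)).differentiableAt two_ne_zero)
      (fun a b => real_inner_comm (mfderiv (𝓡 d) (𝓡 d) e.symm (e (γ t)) b) _) ?_
    rw [← hγ.2 e he ht (deriv (e ∘ γ) t)]
    simp only [chartMetricForm_apply, christoffel, chartMetricDeriv, Function.comp_apply]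
    ring
  refine hchart.congr_of_eventuallyEq ?_
  filter_upwards [hγ.1.continuousAt (e.open_source.mem_nhds ht),
    (contMDiffAt_iff_contMDiffAt_nhds (by simp)).1 hγ.1]
    with s hs hγs
  exact sq_norm_mfderiv_eq_chartMetric (hγs.mdifferentiableAt two_ne_zero) he hs

end Geodesics

section ConstantSpeed

variable {d : ℕ} {M : Type*} [MetricSpace M] [ChartedSpace 𝔼(d) M]
  [Bundle.RiemannianBundle (fun x : M => TangentSpace (𝓡 d) x)]
  {x : M} {w : TangentSpace (𝓡 d) x} {γ : ℝ → M} {t : ℝ}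

theorem exists_isGeodesicFrom_of_mem_expDomain (hw : w ∈ expDomain x) :
    ∃ γ : ℝ → M, IsGeodesicFrom x w γ ∧ γ 1 = riemannianExp x w := by
  have hex : ∃ γ : ℝ → M, IsGeodesicFrom x w γ := hw
  exact ⟨hex.choose, hex.choose_spec, by rw [riemannianExp, dif_pos hex]⟩

theorem IsGeodesicFrom.isGeodesicAt (hγ : IsGeodesicFrom x w γ) (ht : t ∈ Set.Icc (0 : ℝ) 1) :
    IsGeodesicAt d γ t := by
  obtain ⟨⟨ε, hε, hgeo⟩, -⟩ := hγ
  exact hgeo t ⟨by linarith [ht.1], by linarith [ht.2]⟩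

theorem IsGeodesicFrom.mdifferentiableAt (hγ : IsGeodesicFrom x w γ)
    (ht : t ∈ Set.Icc (0 : ℝ) 1) : MDifferentiableAt 𝓘(ℝ, ℝ) (𝓡 d) γ t :=
  (hγ.isGeodesicAt ht).1.mdifferentiableAt two_ne_zero

theorem IsGeodesicFrom.apply_zero (hγ : IsGeodesicFrom x w γ) : γ 0 = x :=
  congrArg Bundle.TotalSpace.proj hγ.2

theorem IsGeodesicFrom.norm_mfderiv_zero (hγ : IsGeodesicFrom x w γ) :
    ‖mfderiv 𝓘(ℝ, ℝ) (𝓡 d) γ 0 (1 : ℝ)‖ = ‖w‖ :=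
  congrArg (fun p : TangentBundle (𝓡 d) M => ‖p.snd‖) hγ.2

variable [IsManifold (𝓡 d) ∞ M]

theorem IsGeodesicFrom.deriv_comp_zero {e : OpenPartialHomeomorph M 𝔼(d)}
    (hγ : IsGeodesicFrom x w γ) (he : e ∈ atlas 𝔼(d) M) (hx : x ∈ e.source) :
    deriv (e ∘ γ) 0 = chartDifferential e x w := by
  rw [deriv_comp_eq_chartDifferential (hγ.mdifferentiableAt (by simp)) he (by rwa [hγ.apply_zero])]
  exact congrArg (fun p : TangentBundle (𝓡 d) M => chartDifferential e p.proj p.snd) hγ.2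

variable [IsContMDiffRiemannianBundle (𝓡 d) ∞ 𝔼(d) (fun x : M => TangentSpace (𝓡 d) x)]

theorem IsGeodesicFrom.norm_mfderiv (hγ : IsGeodesicFrom x w γ) (ht : t ∈ Set.Icc (0 : ℝ) 1) :
    ‖mfderiv 𝓘(ℝ, ℝ) (𝓡 d) γ t (1 : ℝ)‖ = ‖w‖ := by
  have hderiv : ∀ s ∈ Set.Icc (0 : ℝ) 1,
      HasDerivAt (fun s => ‖mfderiv 𝓘(ℝ, ℝ) (𝓡 d) γ s (1 : ℝ)‖ ^ 2) 0 s :=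
    fun s hs => (hγ.isGeodesicAt hs).hasDerivAt_sq_norm_mfderiv
  have hconst := constant_of_has_deriv_right_zero
    (fun s hs => (hderiv s hs).continuousAt.continuousWithinAt)
    (fun s hs => (hderiv s (Set.Ico_subset_Icc_self hs)).hasDerivWithinAt) t ht
  rw [← hγ.norm_mfderiv_zero]
  exact (sq_eq_sq₀ (norm_nonneg _) (norm_nonneg _)).1 hconst

variable [IsRiemannianManifold (𝓡 d) M]

theorem IsGeodesicFrom.dist_le (hγ : IsGeodesicFrom x w γ) (ht : t ∈ Set.Icc (0 : ℝ) 1) :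
    dist x (γ t) ≤ ‖w‖ := by
  have hspeed : ∀ s ∈ Set.Icc (0 : ℝ) 1, ∀ c : ℝ,
      ‖mfderiv 𝓘(ℝ, ℝ) (𝓡 d) γ s c‖ ≤ ‖w‖₊ * ‖c‖ := fun s hs c => by
    have hc : mfderiv 𝓘(ℝ, ℝ) (𝓡 d) γ s c = c • mfderiv 𝓘(ℝ, ℝ) (𝓡 d) γ s (1 : ℝ) :=
      (congrArg _ (mul_one c).symm).trans (map_smul (mfderiv 𝓘(ℝ, ℝ) (𝓡 d) γ s) c (1 : ℝ))
    rw [hc, norm_smul, hγ.norm_mfderiv hs, coe_nnnorm, mul_comm]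
  have hdist := dist_le_mul_dist_of_convex (I' := 𝓡 d) (convex_Icc 0 1)
    (fun s hs => (hγ.isGeodesicAt hs).1.of_le one_le_two) hspeed (x := 0) (by simp) ht
  rw [hγ.apply_zero] at hdist
  refine hdist.trans (mul_le_of_le_one_right (norm_nonneg _) ?_)
  simpa [abs_of_nonneg ht.1] using ht.2

theorem dist_riemannianExp_le (hw : w ∈ expDomain x) : dist x (riemannianExp x w) ≤ ‖w‖ := by
  obtain ⟨γ, hγ, hγ1⟩ := exists_isGeodesicFrom_of_mem_expDomain hw
  exact hγ1 ▸ hγ.dist_le (by simp)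

end ConstantSpeed

section ChartDistortion

variable {d : ℕ} {M : Type*} [MetricSpace M] [ChartedSpace 𝔼(d) M]
  [Bundle.RiemannianBundle (fun x : M => TangentSpace (𝓡 d) x)]
  {e : OpenPartialHomeomorph M 𝔼(d)} {s : Set M} {L : NNReal}

/-- The set `s` lies in the domain of the chart `e`, and over `s` the differential of `e` and its
inverse change norms at most by the factor `L`. -/
structure ChartDistortion (e : OpenPartialHomeomorph M 𝔼(d)) (s : Set M) (L : NNReal) : Prop where
  subset_source : s ⊆ e.source
  norm_chartDifferential_le : ∀ x ∈ s, ∀ v : TangentSpace (𝓡 d) x,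
    ‖chartDifferential e x v‖ ≤ L * ‖v‖
  norm_le : ∀ x ∈ s, ∀ v : TangentSpace (𝓡 d) x, ‖v‖ ≤ L * ‖chartDifferential e x v‖

theorem ChartDistortion.mono {t : Set M} (h : ChartDistortion e s L) (hts : t ⊆ s) :
    ChartDistortion e t L :=
  ⟨hts.trans h.subset_source, fun x hx => h.norm_chartDifferential_le x (hts hx),
    fun x hx => h.norm_le x (hts hx)⟩

variable [IsManifold (𝓡 d) ∞ M]

theorem ChartDistortion.norm_mfderiv_symm_le (h : ChartDistortion e s L) (he : e ∈ atlas 𝔼(d) M)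
    {y : 𝔼(d)} (hy : y ∈ e.target) (hys : e.symm y ∈ s) (a : 𝔼(d)) :
    ‖mfderiv (𝓡 d) (𝓡 d) e.symm y a‖ ≤ L * ‖a‖ := by
  simpa only [chartDifferential_mfderiv_symm he hy] using
    h.norm_le _ hys (mfderiv (𝓡 d) (𝓡 d) e.symm y a)

theorem ChartDistortion.dist_le_of_ball [IsRiemannianManifold (𝓡 d) M] {z : M} {ρ : ℝ}
    (h : ChartDistortion e (Metric.ball z ρ) L) (he : e ∈ atlas 𝔼(d) M) {x : M}
    (hx : x ∈ Metric.ball z ρ) : dist (e z) (e x) ≤ L * dist z x := by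
  refine dist_le_mul_dist_of_ball (I := 𝓡 d) (I' := 𝓡 d) ((contMDiffOn_of_mem_maximalAtlas
    (IsManifold.subset_maximalAtlas he)).mono h.subset_source) (fun y hy v => ?_) hx
  rw [norm_tangentSpace_vectorSpace]
  exact h.norm_chartDifferential_le y hy v

theorem ChartDistortion.dist_symm_le_of_convex [IsRiemannianManifold (𝓡 d) M] {U : Set 𝔼(d)}
    (h : ChartDistortion e s L) (he : e ∈ atlas 𝔼(d) M) (hU : Convex ℝ U) (hUt : U ⊆ e.target)
    (hUs : ∀ y ∈ U, e.symm y ∈ s) {y y' : 𝔼(d)} (hy : y ∈ U) (hy' : y' ∈ U) :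
    dist (e.symm y) (e.symm y') ≤ L * dist y y' :=
  dist_le_mul_dist_of_convex (I' := 𝓡 d) hU (fun _ hy => contMDiffAt_symm_of_mem_maximalAtlas
    (IsManifold.subset_maximalAtlas he) (hUt hy))
    (fun _ hy => h.norm_mfderiv_symm_le he (hUt hy) (hUs _ hy)) hy hy'

theorem exists_chartDistortion_chartAt
    [IsContMDiffRiemannianBundle (𝓡 d) ∞ 𝔼(d) (fun x : M => TangentSpace (𝓡 d) x)] (z : M) :
    ∃ L : NNReal, 1 ≤ L ∧ ∃ r > 0, ChartDistortion (chartAt 𝔼(d) z) (Metric.ball z r) L := by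
  set e := chartAt 𝔼(d) z
  have : IsContinuousRiemannianBundle 𝔼(d) (fun x : M => TangentSpace (𝓡 d) x) := by
    obtain ⟨g, hg, hinner⟩ := IsContMDiffRiemannianBundle.exists_contMDiff (IB := 𝓡 d) (n := ∞)
      (F := 𝔼(d)) (E := fun x : M => TangentSpace (𝓡 d) x)
    exact ⟨g, hg.continuous, hinner⟩
  obtain ⟨C, -, hforward⟩ := eventually_norm_mfderiv_extChartAt_lt (𝓡 d) z
  obtain ⟨C', -, hbackward⟩ := eventually_norm_mfderivWithin_symm_extChartAt_comp_lt (𝓡 d) z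
  obtain ⟨r, hr, hball⟩ := Metric.eventually_nhds_iff_ball.1
    ((hforward.and hbackward).and (chart_source_mem_nhds 𝔼(d) z))
  refine ⟨1 ⊔ (C.toNNReal ⊔ C'.toNNReal), le_sup_left, r, hr, fun x hx => (hball x hx).2,
    fun x hx v => ?_, fun x hx v => ?_⟩
  · have h : ‖chartDifferential e x‖ ≤ C := (hball x hx).1.1.le
    refine (chartDifferential e x).le_of_opNorm_le (h.trans ?_) v
    simp
  · have h := (hball x hx).1.2.le
    rw [modelWithCornersSelf_coe, Set.range_id, mfderivWithin_univ] at h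
    let symmDifferential : 𝔼(d) →L[ℝ] TangentSpace (𝓡 d) (e.symm (e x)) :=
      mfderiv (𝓡 d) (𝓡 d) e.symm (e x)
    have h' : ‖symmDifferential‖ ≤ C' := h
    rw [← norm_mfderiv_symm_chartDifferential (chart_mem_atlas _ z) (hball x hx).2]
    refine symmDifferential.le_of_opNorm_le (h'.trans ?_) _
    simp

end ChartDistortion

section ExponentialMap

theorem closedBall_subset_image_of_approx {V F : Type*} [NormedAddCommGroup V] [NormedSpace ℝ V]
    [CompleteSpace V] [NormedAddCommGroup F] [NormedSpace ℝ F] {A : V →L[ℝ] F} {L : NNReal}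
    (hA : Function.Surjective A) (hL : 0 < L) (hAL : ∀ v, ‖v‖ ≤ L * ‖A v‖) {f : V → F} {b : V}
    {ε : ℝ} (hε : 0 ≤ ε)
    (hf : ∀ v ∈ Metric.closedBall b ε, ∀ w ∈ Metric.closedBall b ε,
      ‖f v - f w - A (v - w)‖ ≤ (2 * L : ℝ)⁻¹ * ‖v - w‖) :
    Metric.closedBall (f b) (ε / (2 * L)) ⊆ f '' Metric.closedBall b ε := by
  let rightInverse : A.NonlinearRightInverse :=
    { toFun := Function.surjInv hA
      nnnorm := L
      bound' := fun y => (hAL _).trans_eq (by rw [Function.surjInv_eq hA])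
      right_inv' := Function.surjInv_eq hA }
  have happrox : ApproximatesLinearOn f A (Metric.closedBall b ε) (2 * L)⁻¹ :=
    fun v hv w hw => by simpa using hf v hv w hw
  have hradius : ((L : ℝ)⁻¹ - ((2 * L : NNReal)⁻¹ : NNReal)) * ε = ε / (2 * L) := by
    push_cast
    field_simp
    ring
  rw [← hradius]
  exact happrox.surjOn_closedBall_of_nonlinearRightInverse rightInverse hε subset_rfl

variable {d : ℕ} {M : Type*} [MetricSpace M] [ChartedSpace 𝔼(d) M]
  [Bundle.RiemannianBundle (fun x : M => TangentSpace (𝓡 d) x)]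
  {e : OpenPartialHomeomorph M 𝔼(d)} {L : NNReal} {ε ρ : ℝ} {z₀ z : M}

/-- A control of geodesics through the ball `B(z₀, 2ρ)` in the chart `e`: norms are distorted at
most by `L`, and the right-hand side of the geodesic equation is Lipschitz, with a constant that
is small compared to the distortion, on a region that contains the coordinates and the coordinate
velocities of all unit time geodesics of speed at most `ρ` that start in `B(z₀, ρ)`. -/
structure GeodesicControl (e : OpenPartialHomeomorph M 𝔼(d)) (z₀ : M) (ρ ε : ℝ) (L : NNReal) :
    Prop where
  mem_atlas : e ∈ atlas 𝔼(d) M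
  one_le : 1 ≤ L
  distortion : ChartDistortion e (Metric.ball z₀ (2 * ρ)) L
  mul_le : L * ρ ≤ ε
  mapsTo : Set.MapsTo e (Metric.ball z₀ (2 * ρ)) (Metric.closedBall (e z₀) ε)
  lipschitz : LipschitzOnWith (4 * L ^ 2)⁻¹
    (fun p : 𝔼(d) × 𝔼(d) => geodesicSpray (chartMetricForm e) p.1 p.2)
    (Metric.closedBall (e z₀) ε ×ˢ Metric.closedBall 0 ε)

variable [IsManifold (𝓡 d) ∞ M]
  [IsContMDiffRiemannianBundle (𝓡 d) ∞ 𝔼(d) (fun x : M => TangentSpace (𝓡 d) x)]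

theorem exists_geodesicControl (z₀ : M) :
    ∃ ρ > 0, ∃ ε, ∃ L, GeodesicControl (chartAt 𝔼(d) z₀) z₀ ρ ε L := by
  obtain ⟨L, hL, r, hr, hdist⟩ := exists_chartDistortion_chartAt (d := d) z₀
  have : 0 < L := one_pos.trans_le hL
  set e := chartAt 𝔼(d) z₀
  have he : e ∈ atlas 𝔼(d) M := chart_mem_atlas _ _
  have hz₀ : z₀ ∈ e.source := mem_chart_source _ _
  obtain ⟨ε, hε, hlip⟩ := exists_lipschitzOnWith_geodesicSpray
    (contDiffAt_chartMetricForm he (e.map_source hz₀))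
    (isInvertible_chartMetricForm he (e.map_source hz₀)) (κ := (4 * L ^ 2)⁻¹) (by positivity)
  obtain ⟨r', hr', hball⟩ := Metric.mem_nhds_iff.1
    ((e.continuousAt hz₀).preimage_mem_nhds (Metric.closedBall_mem_nhds _ hε))
  set ρ := min (min r r' / 2) (ε / L)
  have hρ : 2 * ρ ≤ min r r' := by linarith [min_le_left (min r r' / 2) (ε / L)]
  refine ⟨ρ, by positivity, ε, L, he, hL,
    hdist.mono (Metric.ball_subset_ball (hρ.trans (min_le_left _ _))), ?_,
    fun x hx => hball (Metric.ball_subset_ball (hρ.trans (min_le_right _ _)) hx), hlip⟩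
  calc L * ρ ≤ L * (ε / L) := by gcongr; exact min_le_right _ _
    _ = ε := by field_simp

variable [IsRiemannianManifold (𝓡 d) M]

theorem GeodesicControl.mem_region (h : GeodesicControl e z₀ ρ ε L) (hz : z ∈ Metric.ball z₀ ρ)
    {w : TangentSpace (𝓡 d) z} (hw : ‖w‖ ≤ ρ) {γ : ℝ → M} (hγ : IsGeodesicFrom z w γ) {t : ℝ}
    (ht : t ∈ Set.Icc (0 : ℝ) 1) :
    γ t ∈ Metric.ball z₀ (2 * ρ) ∧ ((e ∘ γ) t, deriv (e ∘ γ) t) ∈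
      Metric.closedBall (e z₀) ε ×ˢ Metric.closedBall (0 : 𝔼(d)) ε := by
  have hγt : γ t ∈ Metric.ball z₀ (2 * ρ) := by
    rw [Metric.mem_ball, dist_comm] at hz ⊢
    linarith [dist_triangle z₀ z (γ t), hγ.dist_le ht]
  refine ⟨hγt, h.mapsTo hγt, mem_closedBall_zero_iff.2 ?_⟩
  rw [deriv_comp_eq_chartDifferential (hγ.mdifferentiableAt ht) h.mem_atlas
    (h.distortion.subset_source hγt)]
  calc _ ≤ L * ‖mfderiv 𝓘(ℝ, ℝ) (𝓡 d) γ t (1 : ℝ)‖ :=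
        h.distortion.norm_chartDifferential_le _ hγt _
    _ ≤ L * ρ := by rw [hγ.norm_mfderiv ht]; gcongr
    _ ≤ ε := h.mul_le

theorem GeodesicControl.hasDerivAt_deriv (h : GeodesicControl e z₀ ρ ε L)
    (hz : z ∈ Metric.ball z₀ ρ) {w : TangentSpace (𝓡 d) z} (hw : ‖w‖ ≤ ρ) {γ : ℝ → M}
    (hγ : IsGeodesicFrom z w γ) {t : ℝ} (ht : t ∈ Set.Icc (0 : ℝ) 1) :
    HasDerivAt (e ∘ γ) (deriv (e ∘ γ) t) t ∧ HasDerivAt (deriv (e ∘ γ))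
      (geodesicSpray (chartMetricForm e) ((e ∘ γ) t) (deriv (e ∘ γ) t)) t := by
  have hgeo := hγ.isGeodesicAt ht
  have hsource := h.distortion.subset_source (h.mem_region hz hw hγ ht).1
  have hu := hgeo.contDiffAt_comp h.mem_atlas hsource
  refine ⟨(hu.differentiableAt two_ne_zero).hasDerivAt, ?_⟩
  rw [Function.comp_apply, ← hgeo.deriv_deriv_eq_geodesicSpray h.mem_atlas hsource]
  exact hasDerivAt_deriv_of_contDiffAt hu

theorem GeodesicControl.norm_comp_sub_le (h : GeodesicControl e z₀ ρ ε L)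
    (hz : z ∈ Metric.ball z₀ ρ) {w w' : TangentSpace (𝓡 d) z} (hw : ‖w‖ ≤ ρ) (hw' : ‖w'‖ ≤ ρ)
    {γ γ' : ℝ → M} (hγ : IsGeodesicFrom z w γ) (hγ' : IsGeodesicFrom z w' γ') :
    ‖e (γ 1) - e (γ' 1) - (deriv (e ∘ γ) 0 - deriv (e ∘ γ') 0)‖ ≤
      2 * ((4 * L ^ 2)⁻¹ : NNReal) * ‖deriv (e ∘ γ) 0 - deriv (e ∘ γ') 0‖ := by
  have hκ : ((4 * L ^ 2)⁻¹ : NNReal) ≤ (1 / 2 : ℝ) := by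
    have hL : (1 : ℝ) ≤ L ^ 2 := one_le_pow₀ h.one_le
    push_cast
    rw [one_div]
    exact inv_anti₀ two_pos (by linarith)
  have hspray : ∀ t ∈ Set.Icc (0 : ℝ) 1,
      ‖geodesicSpray (chartMetricForm e) ((e ∘ γ) t) (deriv (e ∘ γ) t) -
        geodesicSpray (chartMetricForm e) ((e ∘ γ') t) (deriv (e ∘ γ') t)‖ ≤
      ((4 * L ^ 2)⁻¹ : NNReal) *
        max ‖(e ∘ γ) t - (e ∘ γ') t‖ ‖deriv (e ∘ γ) t - deriv (e ∘ γ') t‖ :=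
    fun t ht => by
      simpa only [Prod.mk_sub_mk, Prod.norm_mk] using
        h.lipschitz.norm_sub_le (h.mem_region hz hw hγ ht).2 (h.mem_region hz hw' hγ' ht).2
  exact norm_sub_le_of_norm_second_deriv_le (δ := fun t => (e ∘ γ) t - (e ∘ γ') t)
    (δ' := fun t => deriv (e ∘ γ) t - deriv (e ∘ γ') t)
    (NNReal.coe_nonneg _) hκ
    (fun t ht => ((h.hasDerivAt_deriv hz hw hγ ht).1.sub
      (h.hasDerivAt_deriv hz hw' hγ' ht).1).hasDerivWithinAt)
    (fun t ht => ((h.hasDerivAt_deriv hz hw hγ ht).2.sub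
      (h.hasDerivAt_deriv hz hw' hγ' ht).2).hasDerivWithinAt)
    (by simp [hγ.apply_zero, hγ'.apply_zero]) hspray

theorem GeodesicControl.norm_riemannianExp_sub_le (h : GeodesicControl e z₀ ρ ε L)
    (hz : z ∈ Metric.ball z₀ ρ) {w w' : TangentSpace (𝓡 d) z} (hw : w ∈ expDomain z)
    (hw' : w' ∈ expDomain z) (hwρ : ‖w‖ ≤ ρ) (hwρ' : ‖w'‖ ≤ ρ) :
    ‖e (riemannianExp z w) - e (riemannianExp z w') - chartDifferential e z (w - w')‖ ≤
      (2 * L : ℝ)⁻¹ * ‖w - w'‖ := by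
  obtain ⟨γ, hγ, hγ1⟩ := exists_isGeodesicFrom_of_mem_expDomain hw
  obtain ⟨γ', hγ', hγ1'⟩ := exists_isGeodesicFrom_of_mem_expDomain hw'
  have hzball : z ∈ Metric.ball z₀ (2 * ρ) :=
    Metric.ball_subset_ball (by linarith [dist_nonneg.trans_lt hz]) hz
  have hzsource := h.distortion.subset_source hzball
  have hL : (0 : ℝ) < L := one_pos.trans_le h.one_le
  have key := h.norm_comp_sub_le hz hwρ hwρ' hγ hγ'
  rw [hγ.deriv_comp_zero h.mem_atlas hzsource, hγ'.deriv_comp_zero h.mem_atlas hzsource, hγ1, hγ1',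
    ← map_sub] at key
  calc _ ≤ 2 * ((4 * L ^ 2)⁻¹ : NNReal) * ‖chartDifferential e z (w - w')‖ := key
    _ ≤ 2 * ((4 * L ^ 2)⁻¹ : NNReal) * (L * ‖w - w'‖) := by
        gcongr
        exact h.distortion.norm_chartDifferential_le z hzball _
    _ = (2 * L : ℝ)⁻¹ * ‖w - w'‖ := by
        push_cast
        field_simp
        ring

theorem closedBall_riemannianExp_subset (hz : z ∈ Metric.ball z₀ ρ) {w : TangentSpace (𝓡 d) z}
    (hw : w ∈ expDomain z) :
    Metric.closedBall (riemannianExp z w) (ρ - ‖w‖) ⊆ Metric.ball z₀ (2 * ρ) := by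
  refine Metric.closedBall_subset_ball' ?_
  have hdist := dist_riemannianExp_le hw
  rw [dist_comm] at hdist
  linarith [Metric.mem_ball.1 hz, dist_triangle (riemannianExp z w) z z₀]

theorem GeodesicControl.ball_subset_image_riemannianExp (h : GeodesicControl e z₀ ρ ε L)
    (hz : z ∈ Metric.ball z₀ ρ) {b : TangentSpace (𝓡 d) z} {η : ℝ} (hη : 0 ≤ η)
    (hb : ‖b‖ + η ≤ ρ) (hdom : Metric.closedBall b η ⊆ expDomain z) :
    Metric.ball (riemannianExp z b) (η / (2 * L ^ 2)) ⊆
      riemannianExp z '' Metric.closedBall b η := by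
  have hL : (1 : ℝ) ≤ L := h.one_le
  have hzball : z ∈ Metric.ball z₀ (2 * ρ) :=
    Metric.ball_subset_ball (by linarith [dist_nonneg.trans_lt hz]) hz
  have hnorm : ∀ w ∈ Metric.closedBall b η, ‖w‖ ≤ ρ := fun w hw => by
    linarith [norm_le_norm_add_norm_sub' w b, mem_closedBall_iff_norm.1 hw]
  have hballs : Metric.ball (riemannianExp z b) η ⊆ Metric.ball z₀ (2 * ρ) :=
    (Metric.ball_subset_closedBall.trans (Metric.closedBall_subset_closedBall
      (by linarith))).trans
        (closedBall_riemannianExp_subset hz (hdom (Metric.mem_closedBall_self hη)))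
  have : FiniteDimensional ℝ (TangentSpace (𝓡 d) z) := inferInstanceAs (FiniteDimensional ℝ 𝔼(d))
  have : CompleteSpace (TangentSpace (𝓡 d) z) := FiniteDimensional.complete ℝ _
  have himage := closedBall_subset_image_of_approx (f := fun w => e (riemannianExp z w))
    (chartDifferential_surjective h.mem_atlas (h.distortion.subset_source hzball))
    (one_pos.trans_le h.one_le) (h.distortion.norm_le z hzball) hη fun v hv w hw =>
      h.norm_riemannianExp_sub_le hz (hdom hv) (hdom hw) (hnorm v hv) (hnorm w hw)
  intro x hx
  have hxη : x ∈ Metric.ball (riemannianExp z b) η :=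
    Metric.ball_subset_ball (div_le_self hη (by nlinarith)) hx
  have hdist : dist (e (riemannianExp z b)) (e x) ≤ η / (2 * L) :=
    calc _ ≤ L * dist (riemannianExp z b) x :=
          (h.distortion.mono hballs).dist_le_of_ball h.mem_atlas hxη
      _ ≤ L * (η / (2 * L ^ 2)) := by
          gcongr
          exact (Metric.mem_ball'.1 hx).le
      _ = η / (2 * L) := by field_simp
  obtain ⟨w, hw, hwx⟩ := himage (Metric.mem_closedBall'.2 hdist)
  have hexpw := closedBall_riemannianExp_subset hz (hdom hw)
    (Metric.mem_closedBall_self (sub_nonneg.2 (hnorm w hw)))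
  exact ⟨w, hw, e.injOn (h.distortion.subset_source hexpw)
    (h.distortion.subset_source (hballs hxη)) hwx⟩

end ExponentialMap

section InteriorCone

variable {d : ℕ} {M : Type*} [MetricSpace M] [ChartedSpace 𝔼(d) M]
  [Bundle.RiemannianBundle (fun x : M => TangentSpace (𝓡 d) x)]

theorem closedBall_smul_subset_tangentCone {z : M} {r θ σ : ℝ} (hσ : 0 ≤ σ) (hr : 2 * σ ≤ r)
    (hθ : 0 ≤ Real.cos θ) {v : TangentSpace (𝓡 d) z} (hv : ‖v‖ = 1) :
    Metric.closedBall (σ • v) ((1 - Real.cos θ) / 2 * σ) ⊆ tangentCone r θ v := by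
  intro w hw
  rw [mem_closedBall_iff_norm] at hw
  have hnorm : ‖w‖ ≤ σ + (1 - Real.cos θ) / 2 * σ := by
    have h := norm_le_norm_add_norm_sub' w (σ • v)
    rw [norm_smul, hv, Real.norm_of_nonneg hσ] at h
    linarith
  have hinner : σ - (1 - Real.cos θ) / 2 * σ ≤ inner ℝ v w := by
    have hdecomp : inner ℝ v w = σ + inner ℝ v (w - σ • v) := by
      rw [inner_sub_right, real_inner_smul_right, real_inner_self_eq_norm_sq, hv]
      ring
    have h := neg_le_of_abs_le (abs_real_inner_le_norm v (w - σ • v))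
    rw [hv, one_mul] at h
    linarith
  refine ⟨by nlinarith [Real.cos_le_one θ], ?_⟩
  nlinarith [mul_le_mul_of_nonneg_left hnorm hθ, mul_nonneg hσ (sq_nonneg (1 - Real.cos θ))]

variable [IsManifold (𝓡 d) ∞ M] [IsRiemannianManifold (𝓡 d) M]
  [IsContMDiffRiemannianBundle (𝓡 d) ∞ 𝔼(d) (fun x : M => TangentSpace (𝓡 d) x)]

theorem exists_eventually_ball_subset_image_tangentCone (z₀ : M) {r θ : ℝ} (hr : 0 < r)
    (hθ : 0 < θ) (hθ' : θ < Real.pi / 2) :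
    ∃ c > 0, ∀ᶠ z in 𝓝 z₀, ∀ v : TangentSpace (𝓡 d) z, ‖v‖ = 1 → tangentCone r θ v ⊆ expDomain z →
      ∀ s : ℝ, 0 < s → s ≤ c → ∃ y, dist z y ≤ s ∧
        Metric.ball y (c * s) ⊆ riemannianExp z '' tangentCone r θ v := by
  obtain ⟨ρ, hρ, ε, L, h⟩ := exists_geodesicControl (d := d) z₀
  have hcos : 0 < Real.cos θ := Real.cos_pos_of_mem_Ioo ⟨by linarith, hθ'⟩
  have hcos1 : Real.cos θ < 1 := by
    simpa using Real.cos_lt_cos_of_nonneg_of_le_pi le_rfl (by linarith [Real.pi_pos]) hθ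
  have hL : (0 : ℝ) < L := one_pos.trans_le h.one_le
  set η := (1 - Real.cos θ) / 2
  have hη : 0 < η := by simp only [η]; linarith
  have hη1 : η ≤ 1 := by simp only [η]; linarith
  refine ⟨min (η / (2 * L ^ 2)) (min (ρ / 2) (r / 2)), by positivity, ?_⟩
  filter_upwards [Metric.ball_mem_nhds z₀ hρ] with z hz v hv hdom s hs hsc
  have hsρ : s ≤ ρ / 2 := hsc.trans ((min_le_right _ _).trans (min_le_left _ _))
  have hsr : s ≤ r / 2 := hsc.trans ((min_le_right _ _).trans (min_le_right _ _))
  have hcone : Metric.closedBall (s • v) (η * s) ⊆ tangentCone r θ v :=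
    closedBall_smul_subset_tangentCone hs.le (by linarith) hcos.le hv
  have hnorm : ‖s • v‖ = s := by rw [norm_smul, hv, mul_one, Real.norm_of_nonneg hs.le]
  refine ⟨riemannianExp z (s • v), ?_, ?_⟩
  · exact (dist_riemannianExp_le
      (hdom (hcone (Metric.mem_closedBall_self (by positivity))))).trans_eq hnorm
  · calc Metric.ball _ (min (η / (2 * L ^ 2)) (min (ρ / 2) (r / 2)) * s)
        ⊆ Metric.ball _ (η * s / (2 * L ^ 2)) := Metric.ball_subset_ball <| by
          rw [mul_div_right_comm]
          gcongr
          exact min_le_left _ _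
      _ ⊆ riemannianExp z '' Metric.closedBall (s • v) (η * s) :=
          h.ball_subset_image_riemannianExp hz (by positivity) (by rw [hnorm]; nlinarith)
            (hcone.trans hdom)
      _ ⊆ riemannianExp z '' tangentCone r θ v := Set.image_mono hcone

end InteriorCone

section Volume

variable {d : ℕ} {M : Type*} [MetricSpace M] [ChartedSpace 𝔼(d) M]
  [Bundle.RiemannianBundle (fun x : M => TangentSpace (𝓡 d) x)]
  {e : OpenPartialHomeomorph M 𝔼(d)}

theorem chartVolume_le_riemannianVolume [MeasurableSpace M] (he : e ∈ atlas 𝔼(d) M) :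
    chartVolume e ≤ riemannianVolume d M :=
  le_iSup₂ (f := fun e (_ : e ∈ atlas 𝔼(d) M) => chartVolume e) e he

theorem mul_volume_le_chartVolume [MeasurableSpace M] [BorelSpace M] {s : Set 𝔼(d)} {t : Set M}
    (hs : MeasurableSet s) (ht : MeasurableSet t) (hsub : s ⊆ e.target)
    (hst : Set.MapsTo e.symm s t) {κ : ℝ} (hκ : ∀ y ∈ s, κ ≤ volumeDensity e y) :
    ENNReal.ofReal κ * MeasureTheory.volume s ≤ chartVolume e t := by
  have hmeas : AEMeasurable e.symm ((MeasureTheory.volume.restrict e.target).withDensity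
      (fun y => ENNReal.ofReal (volumeDensity e y))) :=
    (e.continuousOn_symm.aemeasurable e.open_target.measurableSet).mono_ac
      (MeasureTheory.withDensity_absolutelyContinuous _ _)
  rw [chartVolume, MeasureTheory.Measure.map_apply_of_aemeasurable hmeas ht]
  refine le_trans ?_ (MeasureTheory.measure_mono hst)
  rw [MeasureTheory.withDensity_apply _ hs, MeasureTheory.Measure.restrict_restrict hs,
    Set.inter_eq_left.2 hsub, ← MeasureTheory.setLIntegral_const]
  exact MeasureTheory.setLIntegral_mono' hs fun y hy => ENNReal.ofReal_le_ofReal (hκ y hy)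

variable [IsManifold (𝓡 d) ∞ M]

theorem volumeDensity_pos (he : e ∈ atlas 𝔼(d) M) {y : 𝔼(d)} (hy : y ∈ e.target) :
    0 < volumeDensity e y := by
  let push : 𝔼(d) →L[ℝ] TangentSpace (𝓡 d) (e.symm y) := mfderiv (𝓡 d) (𝓡 d) e.symm y
  have hbasis := (EuclideanSpace.basisFun (Fin d) ℝ).toBasis.linearIndependent.map'
    (push : 𝔼(d) →ₗ[ℝ] TangentSpace (𝓡 d) (e.symm y))
    (LinearMap.ker_eq_bot.2 (mfderiv_symm_injective he hy))
  have hframe : LinearIndependent ℝ fun i : Fin d => push (EuclideanSpace.single i 1) := by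
    simpa only [Function.comp_def, OrthonormalBasis.coe_toBasis, EuclideanSpace.basisFun_apply,
      ContinuousLinearMap.coe_coe] using hbasis
  exact Real.sqrt_pos.2 (Matrix.posDef_gram_of_linearIndependent hframe).det_pos

variable [IsContMDiffRiemannianBundle (𝓡 d) ∞ 𝔼(d) (fun x : M => TangentSpace (𝓡 d) x)]

theorem continuousOn_volumeDensity (he : e ∈ atlas 𝔼(d) M) :
    ContinuousOn (volumeDensity e) e.target :=
  Real.continuous_sqrt.comp_continuousOn <| continuous_id.matrix_det.comp_continuousOn <|
    continuousOn_pi.2 fun _ => continuousOn_pi.2 fun _ =>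
      (contDiffOn_chartMetric he _ _).continuousOn

theorem exists_eventually_mapsTo_symm_ball [IsRiemannianManifold (𝓡 d) M] (z₀ : M)
    {U : Set 𝔼(d)} (hU : U ∈ 𝓝 (chartAt 𝔼(d) z₀ z₀)) :
    ∃ L : ℝ, 1 ≤ L ∧ ∃ c > 0, ∀ᶠ z in 𝓝 z₀, ∀ t : ℝ, 0 < t → t ≤ c →
      Metric.ball (chartAt 𝔼(d) z₀ z) (t / L) ⊆ U ∧
      Set.MapsTo (chartAt 𝔼(d) z₀).symm (Metric.ball (chartAt 𝔼(d) z₀ z) (t / L))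
        (Metric.ball z t) := by
  obtain ⟨L, hL, r, hr, h⟩ := exists_chartDistortion_chartAt (d := d) z₀
  have hL1 : (1 : ℝ) ≤ L := hL
  set e := chartAt 𝔼(d) z₀
  have he : e ∈ atlas 𝔼(d) M := chart_mem_atlas _ _
  have hz₀ : z₀ ∈ e.source := mem_chart_source _ _
  have hsymm : ∀ᶠ y in 𝓝 (e z₀), e.symm y ∈ Metric.ball z₀ r :=
    (e.tendsto_symm hz₀).eventually (Metric.ball_mem_nhds _ hr)
  have htarget : ∀ᶠ y in 𝓝 (e z₀), y ∈ e.target := e.open_target.mem_nhds (e.map_source hz₀)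
  obtain ⟨δ, hδ, hball⟩ := Metric.eventually_nhds_iff_ball.1 (hsymm.and (htarget.and hU))
  refine ⟨L, hL1, δ / 2, by positivity, ?_⟩
  filter_upwards [e.open_source.mem_nhds hz₀,
    (e.continuousAt hz₀) (Metric.ball_mem_nhds _ (half_pos hδ))] with z hz hez t ht htδ
  have hsub : Metric.ball (e z) (t / L) ⊆ Metric.ball (e z₀) δ :=
    Metric.ball_subset_ball' (by linarith [div_le_self ht.le hL1, Metric.mem_ball.1 hez])
  refine ⟨fun y hy => (hball y (hsub hy)).2.2, fun y hy => ?_⟩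
  have hdist := h.dist_symm_le_of_convex he (convex_ball (e z₀) δ) (fun y hy => (hball y hy).2.1)
    (fun y hy => (hball y hy).1) (hsub hy) (hsub (Metric.mem_ball_self (by positivity)))
  rw [e.left_inv hz] at hdist
  rw [Metric.mem_ball, lt_div_iff₀' (by positivity)] at hy
  exact hdist.trans_lt hy

theorem exists_eventually_volume_ball_ge [IsRiemannianManifold (𝓡 d) M] [MeasurableSpace M]
    [BorelSpace M] (z₀ : M) :
    ∃ c > 0, ∀ᶠ z in 𝓝 z₀, ∀ t : ℝ, 0 < t → t ≤ c →
      ENNReal.ofReal (c * t ^ d) ≤ riemannianVolume d M (Metric.ball z t) := by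
  set e := chartAt 𝔼(d) z₀
  have he : e ∈ atlas 𝔼(d) M := chart_mem_atlas _ _
  have hez₀ : e z₀ ∈ e.target := e.map_source (mem_chart_source _ _)
  have htarget : e.target ∈ 𝓝 (e z₀) := e.open_target.mem_nhds hez₀
  set κ := volumeDensity e (e z₀) / 2
  have hκ : 0 < κ := half_pos (volumeDensity_pos he hez₀)
  have hdensity : ∀ᶠ y in 𝓝 (e z₀), κ < volumeDensity e y :=
    ((continuousOn_volumeDensity he).continuousAt htarget).eventually_const_lt
      (half_lt_self (volumeDensity_pos he hez₀))
  obtain ⟨L, hL, c, hc, h⟩ := exists_eventually_mapsTo_symm_ball z₀ (hdensity.and htarget)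
  set β := MeasureTheory.volume.real (Metric.ball (0 : 𝔼(d)) 1)
  have hβ : 0 < β := ENNReal.toReal_pos (Metric.measure_ball_pos _ _ one_pos).ne'
    MeasureTheory.measure_ball_lt_top.ne
  refine ⟨min (κ * β / L ^ d) c, by positivity, ?_⟩
  filter_upwards [h] with z hz t ht htc
  obtain ⟨hsub, hmaps⟩ := hz t ht (htc.trans (min_le_right _ _))
  calc ENNReal.ofReal (min (κ * β / L ^ d) c * t ^ d)
      ≤ ENNReal.ofReal (κ * ((t / L) ^ d * β)) := ENNReal.ofReal_le_ofReal <| by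
        calc min (κ * β / L ^ d) c * t ^ d ≤ κ * β / L ^ d * t ^ d := by
              gcongr
              exact min_le_left _ _
          _ = κ * ((t / L) ^ d * β) := by rw [div_pow]; ring
    _ = ENNReal.ofReal κ * MeasureTheory.volume (Metric.ball (e z) (t / L)) := by
        rw [MeasureTheory.Measure.addHaar_ball_of_pos _ _ (by positivity),
          finrank_euclideanSpace_fin, ENNReal.ofReal_mul hκ.le, ENNReal.ofReal_mul (by positivity),
          MeasureTheory.ofReal_measureReal]
    _ ≤ chartVolume e (Metric.ball z t) :=
        mul_volume_le_chartVolume measurableSet_ball measurableSet_ball (fun y hy => (hsub hy).2)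
          hmaps fun y hy => (hsub hy).1.le
    _ ≤ riemannianVolume d M (Metric.ball z t) := chartVolume_le_riemannianVolume he _

end Volume

section Uniformity

theorem exists_pos_le_one_mul_le (a : ℝ) {b : ℝ} (hb : 0 < b) : ∃ κ > 0, κ ≤ 1 ∧ κ * a ≤ b := by
  have ha : 0 < max a 1 := one_pos.trans_le (le_max_right _ _)
  exact ⟨min 1 (b / max a 1), by positivity, min_le_left _ _,
    (mul_le_mul_of_nonneg_left (le_max_left a 1) (by positivity)).trans
      ((le_div_iff₀ ha).1 (min_le_right _ _))⟩

theorem exists_pos_forall_mem_of_eventually {X : Type*} [TopologicalSpace X] {Ω : Set X}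
    (hΩ : IsCompact Ω) {Q : ℝ → X → Prop} (anti : ∀ z c c', 0 < c' → c' ≤ c → Q c z → Q c' z)
    (hQ : ∀ z₀ ∈ Ω, ∃ c > 0, ∀ᶠ z in 𝓝[Ω] z₀, Q c z) : ∃ c > 0, ∀ z ∈ Ω, Q c z := by
  refine hΩ.induction_on (p := fun S => ∃ c > 0, ∀ z ∈ S, Q c z) ⟨1, one_pos, by simp⟩ ?_ ?_ ?_
  · exact fun S T hST ⟨c, hc, h⟩ => ⟨c, hc, fun z hz => h z (hST hz)⟩
  · rintro S T ⟨c, hc, hS⟩ ⟨c', hc', hT⟩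
    refine ⟨min c c', lt_min hc hc', fun z hz => hz.elim (fun hz => ?_) fun hz => ?_⟩
    · exact anti z c _ (lt_min hc hc') (min_le_left _ _) (hS z hz)
    · exact anti z c' _ (lt_min hc hc') (min_le_right _ _) (hT z hz)
  · intro z₀ hz₀
    obtain ⟨c, hc, h⟩ := hQ z₀ hz₀
    exact ⟨{z | Q c z}, h, c, hc, fun z hz => hz⟩

variable {d : ℕ} {M : Type*} [MetricSpace M] [ChartedSpace (𝔼(d)) M]
  [IsManifold (𝓡 d) ∞ M] [Bundle.RiemannianBundle (fun x : M => TangentSpace (𝓡 d) x)]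
  [IsContMDiffRiemannianBundle (𝓡 d) ∞ (𝔼(d))
    (fun x : M => TangentSpace (𝓡 d) x)]
  [IsRiemannianManifold (𝓡 d) M] {Ω : Set M}

theorem exists_volume_ball_mul_ge [MeasurableSpace M] [BorelSpace M] (hΩ : IsCompact Ω) {ν : ℝ}
    (hν : 0 < ν) (T : ℝ) :
    ∃ V > 0, V ≤ 1 ∧ ∀ z ∈ Ω, ∀ R : ℝ, 0 < R → R ≤ T →
      ENNReal.ofReal (V * R ^ d) ≤ riemannianVolume d M (Metric.ball z (ν * R)) := by
  obtain ⟨c, hc, h⟩ := exists_pos_forall_mem_of_eventually hΩ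
    (Q := fun c z => ∀ t : ℝ, 0 < t → t ≤ c →
      ENNReal.ofReal (c * t ^ d) ≤ riemannianVolume d M (Metric.ball z t))
    (fun z c c' _ hcc' h t ht htc =>
      (ENNReal.ofReal_le_ofReal (by gcongr)).trans (h t ht (htc.trans hcc')))
    fun z₀ _ => (exists_eventually_volume_ball_ge z₀).imp fun c hc =>
      ⟨hc.1, hc.2.filter_mono nhdsWithin_le_nhds⟩
  obtain ⟨κ, hκ, hκ1, hκT⟩ := exists_pos_le_one_mul_le (ν * T) hc
  refine ⟨min 1 (c * (κ * ν) ^ d), by positivity, min_le_left _ _, fun z hz R hR hRT => ?_⟩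
  calc ENNReal.ofReal (min 1 (c * (κ * ν) ^ d) * R ^ d)
      ≤ ENNReal.ofReal (c * (κ * (ν * R)) ^ d) := ENNReal.ofReal_le_ofReal <| by
        rw [← mul_assoc κ, mul_pow _ R, ← mul_assoc]
        gcongr
        exact min_le_right _ _
    _ ≤ riemannianVolume d M (Metric.ball z (κ * (ν * R))) :=
        h z hz _ (by positivity) (hκT.trans' (by gcongr))
    _ ≤ riemannianVolume d M (Metric.ball z (ν * R)) := MeasureTheory.measure_mono
        (Metric.ball_subset_ball (mul_le_of_le_one_left (by positivity) hκ1))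

theorem DomainAssumption.exists_ball_subset {rb θ : ℝ} (hΩ : DomainAssumption d Ω rb θ) (T : ℝ) :
    ∃ c > 0, ∀ z ∈ Ω, ∀ s : ℝ, 0 < s → s ≤ T → ∃ y, dist z y ≤ s ∧ Metric.ball y (c * s) ⊆ Ω := by
  obtain ⟨c, hc, h⟩ := exists_pos_forall_mem_of_eventually hΩ.isCompact
    (Q := fun c z => ∀ s : ℝ, 0 < s → s ≤ c → ∃ y, dist z y ≤ s ∧ Metric.ball y (c * s) ⊆ Ω)
    (fun z c c' _ hcc' h s hs hsc => (h s hs (hsc.trans hcc')).imp fun y hy =>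
      ⟨hy.1, hy.2.trans' (Metric.ball_subset_ball (by gcongr))⟩)
    fun z₀ _ => by
      obtain ⟨c, hc, h⟩ := exists_eventually_ball_subset_image_tangentCone (d := d) z₀ hΩ.rb_pos
        hΩ.aperture_pos hΩ.aperture_lt
      refine ⟨c, hc, ?_⟩
      filter_upwards [h.filter_mono nhdsWithin_le_nhds, self_mem_nhdsWithin] with z hz hzΩ s hs hsc
      obtain ⟨v, hv, hdom, hcone⟩ := hΩ.cone z hzΩ
      obtain ⟨y, hy, hball⟩ := hz v hv hdom s hs hsc
      exact ⟨y, hy, hball.trans (Set.image_subset_iff.2 hcone)⟩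
  obtain ⟨κ, hκ, hκ1, hκT⟩ := exists_pos_le_one_mul_le T hc
  refine ⟨c * κ, by positivity, fun z hz s hs hsT => ?_⟩
  obtain ⟨y, hy, hball⟩ := h z hz (κ * s) (by positivity) (hκT.trans' (by gcongr))
  exact ⟨y, hy.trans (mul_le_of_le_one_left hs.le hκ1), by rwa [mul_assoc]⟩

theorem DomainAssumption.exists_ball_subset_ball_inter {rb θ : ℝ}
    (hΩ : DomainAssumption d Ω rb θ) (T : ℝ) :
    ∃ k : ℕ, ∀ x ∈ Ω, ∀ R : ℝ, 0 < R → R ≤ T →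
      ∃ y, dist x y ≤ R / 4 ∧ Metric.ball y (R / 2 ^ k) ⊆ Metric.ball x R ∩ Ω := by
  obtain ⟨c, hc, h⟩ := hΩ.exists_ball_subset T
  obtain ⟨k, hk⟩ := pow_unbounded_of_one_lt (max 2 (4 / c)) one_lt_two
  rw [max_lt_iff, div_lt_iff₀ hc] at hk
  refine ⟨k, fun x hx R hR hRT => ?_⟩
  obtain ⟨y, hy, hyΩ⟩ := h x hx (R / 4) (by positivity) (by linarith)
  refine ⟨y, hy, Set.subset_inter (Metric.ball_subset_ball' ?_) (hyΩ.trans' ?_)⟩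
  · have : R / 2 ^ k ≤ R / 2 := by gcongr; exact hk.1.le
    rw [dist_comm]
    linarith
  · refine Metric.ball_subset_ball ((div_le_iff₀ (by positivity)).2 ?_)
    nlinarith

end Uniformity

section Nikolskii

theorem ofReal_le_mul_eLpNorm {α : Type*} [MeasurableSpace α] {μ : MeasureTheory.Measure α}
    {f : α → ℝ} {s t : Set α} (hs : MeasurableSet s) (hst : s ⊆ t) {a V q R : ℝ} {d : ℕ}
    (ha : 0 ≤ a) (hf : ∀ x ∈ s, a ≤ ‖f x‖) (hV : 0 < V) (hV1 : V ≤ 1) (hq : 1 ≤ q) (hR : 0 < R)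
    (hμ : ENNReal.ofReal (V * R ^ d) ≤ μ s) :
    ENNReal.ofReal a ≤ ENNReal.ofReal (V⁻¹ * R ^ (-(d : ℝ) / q)) *
      MeasureTheory.eLpNorm f (ENNReal.ofReal q) (μ.restrict t) := by
  have hq0 : 0 < q := one_pos.trans_le hq
  have hVq : V ≤ V ^ (1 / q) := Real.self_le_rpow_of_le_one hV.le hV1 ((div_le_one hq0).2 hq)
  have hRd : R ^ (-(d : ℝ) / q) * R ^ ((d : ℝ) / q) = 1 := by
    rw [← Real.rpow_add hR, neg_div, neg_add_cancel, Real.rpow_zero]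
  have hmass : ENNReal.ofReal (V * R ^ ((d : ℝ) / q)) ≤ μ s ^ (1 / q) :=
    calc ENNReal.ofReal (V * R ^ ((d : ℝ) / q))
        ≤ ENNReal.ofReal ((V * R ^ d) ^ (1 / q)) := ENNReal.ofReal_le_ofReal <| by
          rw [Real.mul_rpow hV.le (by positivity), ← Real.rpow_natCast, ← Real.rpow_mul hR.le,
            mul_one_div]
          gcongr
      _ = ENNReal.ofReal (V * R ^ d) ^ (1 / q) :=
          (ENNReal.ofReal_rpow_of_pos (by positivity)).symm
      _ ≤ μ s ^ (1 / q) := by gcongr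
  have hnorm : ENNReal.ofReal a * μ s ^ (1 / q) ≤
      MeasureTheory.eLpNorm f (ENNReal.ofReal q) (μ.restrict t) :=
    calc ENNReal.ofReal a * μ s ^ (1 / q)
        = MeasureTheory.eLpNorm (fun _ => a) (ENNReal.ofReal q) (μ.restrict s) := by
          rw [MeasureTheory.eLpNorm_const' _ (by simpa using hq0) ENNReal.ofReal_ne_top,
            ENNReal.toReal_ofReal hq0.le, MeasureTheory.Measure.restrict_apply_univ,
            Real.enorm_eq_ofReal ha]
      _ ≤ MeasureTheory.eLpNorm f (ENNReal.ofReal q) (μ.restrict s) := by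
          refine MeasureTheory.eLpNorm_mono_ae ?_
          filter_upwards [MeasureTheory.self_mem_ae_restrict hs] with x hx
          exact (Real.norm_of_nonneg ha).trans_le (hf x hx)
      _ ≤ MeasureTheory.eLpNorm f (ENNReal.ofReal q) (μ.restrict t) :=
          MeasureTheory.eLpNorm_mono_measure f (MeasureTheory.Measure.restrict_mono hst le_rfl)
  calc ENNReal.ofReal a
      = ENNReal.ofReal (V⁻¹ * R ^ (-(d : ℝ) / q)) *
          (ENNReal.ofReal a * ENNReal.ofReal (V * R ^ ((d : ℝ) / q))) := by
        rw [← ENNReal.ofReal_mul ha, ← ENNReal.ofReal_mul (by positivity)]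
        congr 1
        calc a = a * (V⁻¹ * V) * (R ^ (-(d : ℝ) / q) * R ^ ((d : ℝ) / q)) := by
              rw [hRd, inv_mul_cancel₀ hV.ne', mul_one, mul_one]
          _ = _ := by ring
    _ ≤ _ := by
        gcongr
        exact hnorm.trans' (by gcongr)

variable {M : Type*} {p : M → ℝ}

theorem supNorm_mono {s t : Set M} (h : s ⊆ t) : supNorm p s ≤ supNorm p t :=
  biSup_mono h

theorem exists_lt_norm_of_ofReal_lt_supNorm {s : Set M} {a : ℝ} (ha : 0 ≤ a)
    (h : ENNReal.ofReal a < supNorm p s) : ∃ x ∈ s, a < ‖p x‖ := by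
  obtain ⟨x, hx, hax⟩ := lt_biSup_iff.1 h
  rw [← ofReal_norm, ENNReal.ofReal_lt_ofReal_iff_of_nonneg ha] at hax
  exact ⟨x, hx, hax⟩

variable [MetricSpace M]

theorem supNorm_ne_top {s Ω : Set M} (hΩ : IsCompact Ω) (hs : s ⊆ Ω) (hp : Continuous p) :
    supNorm p s ≠ ⊤ := by
  obtain ⟨C, hC⟩ := hΩ.exists_bound_of_continuousOn hp.continuousOn
  refine ((iSup₂_le fun x hx => ?_ : supNorm p s ≤ ENNReal.ofReal C).trans_lt
    ENNReal.ofReal_lt_top).ne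
  rw [← ofReal_norm]
  exact ENNReal.ofReal_le_ofReal (hC x (hs hx))

variable {d : ℕ} [ChartedSpace (𝔼(d)) M]
  [Bundle.RiemannianBundle (fun x : M => TangentSpace (𝓡 d) x)] {D K rs : ℝ}

/-- The hypotheses on a single function `p`: it is `C¹` and satisfies the doubling property with
constant `2^D` and the Markov inequality with constant `K` on balls of radius less than `rs`. -/
structure IsDoublingMarkov (d : ℕ) {M : Type*} [MetricSpace M]
    [ChartedSpace (𝔼(d)) M]
    [Bundle.RiemannianBundle (fun x : M => TangentSpace (𝓡 d) x)]
    (p : M → ℝ) (D K rs : ℝ) : Prop where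
  contMDiff : ContMDiff (𝓡 d) 𝓘(ℝ, ℝ) 1 p
  doubling : ∀ r : ℝ, 0 < r → r < rs → ∀ x : M,
    supNorm p (Metric.ball x (2 * r)) ≤ ENNReal.ofReal (2 ^ D) * supNorm p (Metric.ball x r)
  markov : ∀ r : ℝ, 0 < r → r < rs → ∀ x : M,
    gradSupNorm d p (Metric.ball x r) ≤ ENNReal.ofReal (K / r) * supNorm p (Metric.ball x r)

theorem FunctionSpaceAssumption.isDoublingMarkov {P : Submodule ℝ (M → ℝ)}
    (hP : FunctionSpaceAssumption d P D K rs) (hp : p ∈ P) : IsDoublingMarkov d p D K rs :=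
  ⟨hP.contMDiff p hp, hP.doubling p hp, hP.markov p hp⟩

theorem norm_mfderiv_le_of_gradNorm_le {x : M} {G : NNReal} (h : gradNorm d p x ≤ G)
    (w : TangentSpace (𝓡 d) x) : ‖mfderiv (𝓡 d) 𝓘(ℝ, ℝ) p x w‖ ≤ G * ‖w‖ := by
  rcases eq_or_ne w 0 with rfl | hw
  · simp
  · rw [norm_tangentSpace_vectorSpace]
    refine (div_le_iff₀ (norm_pos_iff.2 hw)).1 ((ENNReal.ofReal_le_ofReal_iff G.2).1 ?_)
    rw [← ENNReal.ofReal_coe_nnreal] at h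
    exact (le_iSup₂ (f := fun (V : TangentSpace (𝓡 d) x) (_ : V ≠ 0) =>
      ENNReal.ofReal (|(show ℝ from mfderiv (𝓡 d) 𝓘(ℝ, ℝ) p x V)| / ‖V‖)) w hw).trans h

theorem IsDoublingMarkov.supNorm_ball_two_pow_mul_le (hp : IsDoublingMarkov d p D K rs) {x : M}
    {r : ℝ} (hr : 0 < r) (k : ℕ) (hk : ∀ j < k, 2 ^ j * r < rs) :
    supNorm p (Metric.ball x (2 ^ k * r)) ≤
      ENNReal.ofReal (2 ^ D) ^ k * supNorm p (Metric.ball x r) := by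
  induction k with
  | zero => simp
  | succ k ih =>
    have hdouble := hp.doubling (2 ^ k * r) (by positivity) (hk k (Nat.lt_succ_self k)) x
    rw [pow_succ', mul_assoc, pow_succ', mul_assoc]
    exact hdouble.trans (by gcongr; exact ih fun j hj => hk j (hj.trans (Nat.lt_succ_self k)))

theorem IsDoublingMarkov.supNorm_closure_ball_le (hp : IsDoublingMarkov d p D K rs) {x y : M}
    {r R : ℝ} (hR : 0 < R) (hRrs : R ≤ rs) (hxy : dist x y ≤ R / 4) {k : ℕ}
    (hr : 2 ^ k * r = 3 / 2 * R) :
    supNorm p (closure (Metric.ball x R)) ≤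
      ENNReal.ofReal (2 ^ D) ^ k * supNorm p (Metric.ball y r) := by
  have hr0 : 0 < r := pos_of_mul_pos_right (hr ▸ by positivity : 0 < 2 ^ k * r) (by positivity)
  have hcover : closure (Metric.ball x R) ⊆ Metric.ball y (2 ^ k * r) :=
    Metric.closure_ball_subset_closedBall.trans
      (Metric.closedBall_subset_ball' (by rw [hr]; linarith))
  refine (supNorm_mono hcover).trans (hp.supNorm_ball_two_pow_mul_le hr0 k fun j hj => ?_)
  have hjk : (2 : ℝ) ^ j * 2 ≤ 2 ^ k := (pow_succ (2 : ℝ) j).symm.trans_le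
    (pow_le_pow_right₀ one_le_two hj)
  nlinarith

theorem IsDoublingMarkov.gradNorm_le (hp : IsDoublingMarkov d p D K rs) {x y : M} {r m : ℝ}
    (hr : 0 < r) (hrs : 2 * r < rs) (hm : 0 ≤ m)
    (hsup : supNorm p (Metric.ball y r) = ENNReal.ofReal m) (hx : x ∈ Metric.ball y (2 * r)) :
    gradNorm d p x ≤ ENNReal.ofReal (K / (2 * r) * (2 ^ D * m)) := by
  calc gradNorm d p x ≤ gradSupNorm d p (Metric.ball y (2 * r)) :=
        le_iSup₂ (f := fun x (_ : x ∈ Metric.ball y (2 * r)) => gradNorm d p x) x hx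
    _ ≤ ENNReal.ofReal (K / (2 * r)) * supNorm p (Metric.ball y (2 * r)) :=
        hp.markov (2 * r) (by positivity) hrs y
    _ ≤ ENNReal.ofReal (K / (2 * r)) * (ENNReal.ofReal (2 ^ D) * ENNReal.ofReal m) := by
        gcongr
        exact hsup ▸ hp.doubling r hr (by linarith) y
    _ = ENNReal.ofReal (K / (2 * r) * (2 ^ D * m)) := by
        rw [← ENNReal.ofReal_mul (by positivity), ← ENNReal.ofReal_mul' (by positivity)]

variable [IsRiemannianManifold (𝓡 d) M]

theorem IsDoublingMarkov.exists_ball_forall_le_norm (hp : IsDoublingMarkov d p D K rs) {y : M}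
    {r δ m : ℝ} (hr : 0 < r) (hrs : 2 * r < rs) (hδ : δ ≤ 1) (hKδ : δ * (K * 2 ^ D) ≤ 1 / 2)
    (hm : 0 < m) (hsup : supNorm p (Metric.ball y r) = ENNReal.ofReal m) :
    ∃ z ∈ Metric.ball y r, ∀ x ∈ Metric.ball z (δ * r), m / 4 ≤ ‖p x‖ := by
  obtain ⟨z, hz, hpz⟩ : ∃ z ∈ Metric.ball y r, m / 2 < ‖p z‖ :=
    exists_lt_norm_of_ofReal_lt_supNorm (by positivity)
      (hsup ▸ (ENNReal.ofReal_lt_ofReal_iff hm).2 (half_lt_self hm))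
  refine ⟨z, hz, fun x hx => ?_⟩
  have hsub : Metric.ball z (δ * r) ⊆ Metric.ball y (2 * r) :=
    Metric.ball_subset_ball' (by nlinarith [Metric.mem_ball.1 hz])
  set G : ℝ := K / (2 * r) * (2 ^ D * m)
  have hG : max G 0 * (δ * r) ≤ m / 4 := by
    have hδr : 0 ≤ δ * r := (dist_nonneg.trans_lt (Metric.mem_ball.1 hx)).le
    rw [max_mul_of_nonneg _ _ hδr, zero_mul]
    refine max_le ?_ (by positivity)
    calc G * (δ * r) = δ * (K * 2 ^ D) * (m / 2) := by simp only [G]; field_simp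
      _ ≤ 1 / 2 * (m / 2) := by gcongr
      _ = m / 4 := by ring
  have hosc : dist (p z) (p x) ≤ max G 0 * dist z x := by
    rw [← Real.coe_toNNReal']
    exact dist_le_mul_dist_of_ball hp.contMDiff.contMDiffOn (fun x hx =>
      norm_mfderiv_le_of_gradNorm_le (hp.gradNorm_le hr hrs hm.le hsup (hsub hx))) hx
  have hzx : max G 0 * dist z x ≤ max G 0 * (δ * r) := by
    gcongr
    exact (Metric.mem_ball'.1 hx).le
  have := norm_sub_norm_le (p z) (p x)
  rw [dist_eq_norm] at hosc
  linarith

theorem IsDoublingMarkov.supNorm_ball_le_eLpNorm [MeasurableSpace M] [OpensMeasurableSpace M]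
    {μ : MeasureTheory.Measure M} (hp : IsDoublingMarkov d p D K rs) {y : M} {S : Set M}
    {r R δ V q : ℝ} (hr : 0 < r) (hrs : 2 * r < rs) (hS : Metric.ball y (2 * r) ⊆ S)
    (hfin : supNorm p (Metric.ball y r) ≠ ⊤) (hδ : δ ≤ 1) (hKδ : δ * (K * 2 ^ D) ≤ 1 / 2)
    (hV : 0 < V) (hV1 : V ≤ 1) (hR : 0 < R) (hq : 1 ≤ q)
    (hμ : ∀ z ∈ Metric.ball y r, ENNReal.ofReal (V * R ^ d) ≤ μ (Metric.ball z (δ * r))) :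
    supNorm p (Metric.ball y r) ≤ ENNReal.ofReal (4 * (V⁻¹ * R ^ (-(d : ℝ) / q))) *
      MeasureTheory.eLpNorm p (ENNReal.ofReal q) (μ.restrict S) := by
  rcases eq_or_ne (supNorm p (Metric.ball y r)) 0 with h0 | h0
  · exact h0 ▸ zero_le
  set m := (supNorm p (Metric.ball y r)).toReal
  have hm : 0 < m := ENNReal.toReal_pos h0 hfin
  have hsup : supNorm p (Metric.ball y r) = ENNReal.ofReal m := (ENNReal.ofReal_toReal hfin).symm
  obtain ⟨z, hz, hzp⟩ := hp.exists_ball_forall_le_norm hr hrs hδ hKδ hm hsup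
  have hzS : Metric.ball z (δ * r) ⊆ S :=
    hS.trans' (Metric.ball_subset_ball' (by nlinarith [Metric.mem_ball.1 hz]))
  have hLq :=
    ofReal_le_mul_eLpNorm measurableSet_ball hzS (by positivity) hzp hV hV1 hq hR (hμ z hz)
  calc supNorm p (Metric.ball y r) = ENNReal.ofReal 4 * ENNReal.ofReal (m / 4) := by
        rw [hsup, ← ENNReal.ofReal_mul zero_le_four, mul_div_cancel₀ _ four_ne_zero]
    _ ≤ _ := by
        rw [ENNReal.ofReal_mul zero_le_four, mul_assoc]
        gcongr

end Nikolskii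

end RiemannianNikolskii

end

open RiemannianNikolskii in
theorem corollary3p5_general {d : ℕ} {M : Type*} [MetricSpace M]
    [ChartedSpace (EuclideanSpace ℝ (Fin d)) M] [IsManifold (𝓡 d) ∞ M]
    [Bundle.RiemannianBundle (fun x : M => TangentSpace (𝓡 d) x)]
    [IsContMDiffRiemannianBundle (𝓡 d) ∞ (EuclideanSpace ℝ (Fin d))
      (fun x : M => TangentSpace (𝓡 d) x)]
    [IsRiemannianManifold (𝓡 d) M]
    [MeasurableSpace M] [BorelSpace M]
    (D K rs : ℝ) {Ω : Set M} {rb θ : ℝ}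
    (hΩ : DomainAssumption d Ω rb θ) :
    ∃ N : ℝ, 0 < N ∧
      ∀ q : ℝ, 1 ≤ q →
      ∀ x₀ ∈ Ω, ∀ R : ℝ, 0 < R → R ≤ rs →
      ∀ p : M → ℝ, IsDoublingMarkov d p D K rs →
        supNorm p (closure (Metric.ball x₀ R) ∩ Ω) ≤
          ENNReal.ofReal (N * R ^ (-(d : ℝ) / q)) *
            MeasureTheory.eLpNorm p (ENNReal.ofReal q)
              ((riemannianVolume d M).restrict (Metric.ball x₀ R ∩ Ω)) := by
  obtain ⟨k, hcone⟩ := hΩ.exists_ball_subset_ball_inter rs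
  obtain ⟨δ, hδ, hδ1, hKδ⟩ := exists_pos_le_one_mul_le (K * 2 ^ D) (one_half_pos (α := ℝ))
  obtain ⟨V, hV, hV1, hvol⟩ := exists_volume_ball_mul_ge (d := d) hΩ.isCompact
    (ν := δ * (3 / 8 / 2 ^ k)) (by positivity) rs
  refine ⟨(2 ^ D) ^ (k + 2) * (4 * V⁻¹), by positivity, fun q hq x₀ hx₀ R hR hRrs p hp => ?_⟩
  obtain ⟨y, hxy, hball⟩ := hcone x₀ hx₀ R hR hRrs
  set r := 3 / 8 / 2 ^ k * R
  have hr : 0 < r := by positivity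
  have hRk : R / 2 ^ k ≤ R := div_le_self hR.le (one_le_pow₀ one_le_two)
  have h2r : 2 * r < R / 2 ^ k := by
    have : 0 < R / 2 ^ k := by positivity
    calc 2 * r = 3 / 4 * (R / 2 ^ k) := by ring
      _ < R / 2 ^ k := by linarith
  have hsub : Metric.ball y (2 * r) ⊆ Metric.ball x₀ R ∩ Ω :=
    hball.trans' (Metric.ball_subset_ball h2r.le)
  have hsubΩ : Metric.ball y r ⊆ Ω := fun x hx =>
    (hsub (Metric.ball_subset_ball (by linarith) hx)).2
  calc supNorm p (closure (Metric.ball x₀ R) ∩ Ω)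
      ≤ supNorm p (closure (Metric.ball x₀ R)) := supNorm_mono Set.inter_subset_left
    _ ≤ ENNReal.ofReal (2 ^ D) ^ (k + 2) * supNorm p (Metric.ball y r) :=
        hp.supNorm_closure_ball_le hR hRrs hxy (by simp only [r, pow_add]; field_simp; norm_num)
    _ ≤ ENNReal.ofReal (2 ^ D) ^ (k + 2) * (ENNReal.ofReal (4 * (V⁻¹ * R ^ (-(d : ℝ) / q))) *
          MeasureTheory.eLpNorm p (ENNReal.ofReal q)
            ((riemannianVolume d M).restrict (Metric.ball x₀ R ∩ Ω))) := by
        gcongr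
        exact hp.supNorm_ball_le_eLpNorm hr (by linarith) hsub
          (supNorm_ne_top hΩ.isCompact hsubΩ hp.contMDiff.continuous)
          hδ1 hKδ hV hV1 hR hq fun z hz =>
            (hvol z (hsubΩ hz) R hR hRrs).trans_eq (by rw [mul_assoc])
    _ = _ := by
        rw [← mul_assoc, ← ENNReal.ofReal_pow (by positivity), ← ENNReal.ofReal_mul (by positivity),
          ← mul_assoc 4, ← mul_assoc]

theorem corollary3p5 {d : ℕ} {M : Type*} [MetricSpace M] [ConnectedSpace M]
    [ChartedSpace (EuclideanSpace ℝ (Fin d)) M] [IsManifold (𝓡 d) ∞ M]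
    [Bundle.RiemannianBundle (fun x : M => TangentSpace (𝓡 d) x)]
    [IsContMDiffRiemannianBundle (𝓡 d) ∞ (EuclideanSpace ℝ (Fin d))
      (fun x : M => TangentSpace (𝓡 d) x)]
    [IsRiemannianManifold (𝓡 d) M]
    [MeasurableSpace M] [BorelSpace M]
    (P : Submodule ℝ (M → ℝ)) (D K rs : ℝ)
    (hP : RiemannianNikolskii.FunctionSpaceAssumption d P D K rs)
    (Ω : Set M) (rb θ : ℝ)
    (hΩ : RiemannianNikolskii.DomainAssumption d Ω rb θ) :
    ∃ N : ℝ, 0 < N ∧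
      ∀ q : ℝ, 1 ≤ q →
      ∀ x₀ ∈ Ω, ∀ R : ℝ, 0 < R → ENNReal.ofReal R ≤ RiemannianNikolskii.rStar d Ω rs rb →
      ∀ p ∈ P,
        RiemannianNikolskii.supNorm p (closure (Metric.ball x₀ R) ∩ Ω) ≤
          ENNReal.ofReal (N * R ^ (-(d : ℝ) / q)) *
            MeasureTheory.eLpNorm p (ENNReal.ofReal q)
              ((RiemannianNikolskii.riemannianVolume d M).restrict (Metric.ball x₀ R ∩ Ω)) := by
  obtain ⟨N, hN, h⟩ := corollary3p5_general D K rs hΩ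
  exact ⟨N, hN, fun q hq x₀ hx₀ R hR hRr p hp => h q hq x₀ hx₀ R hR
    ((ENNReal.ofReal_le_ofReal_iff hP.rs_pos.le).1 <|
      hRr.trans ((min_le_right _ _).trans (min_le_left _ _))) p (hP.isDoublingMarkov hp)⟩
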